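/- Corollary 4.2. Let $n\ge 0$ and let $M$ be a non-empty smooth manifold of dimension $m=4n+3$. Put $\epsilon_1=1$, $\epsilon_2=\epsilon_3=-1$. A mixed 3-structure on $M$ consists of smooth endomorphism fields $\phi_\alpha$ of $TM$, smooth vector fields $\xi_\alpha$ and smooth $1$-forms $\eta_\alpha$ ($\alpha=1,2,3$) with $$\phi_\alpha^2=-\epsilon_\alpha I+\eta_\alpha\otimes\xi_\alpha,\qquad \eta_\alpha(\xi_\alpha)=\epsilon_\alpha,\qquad \eta_\alpha(\xi_\beta)=0\ \ (\alpha\ne\beta),$$ and, for every even permutation $(\alpha,\beta,\gamma)$ of $(1,2,3)$, $$\phi_\alpha(\xi_\beta)=-\phi_\beta(\xi_\alpha)=\epsilon_\gamma\xi_\gamma,\qquad \eta_\alpha\circ\phi_\beta=-\eta_\beta\circ\phi_\alpha=\epsilon_\gamma\eta_\gamma,$$ $$\phi_\alpha\phi_\beta-\eta_\beta\otimes\xi_\alpha=-\phi_\beta\phi_\alpha+\eta_\alpha\otimes\xi_\beta=\epsilon_\gamma\phi_\gamma .$$ Let $g$ be a semi-Riemannian metric on $M$ with Levi-Civita connection $\nabla$.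 The structure is called mixed 3-Sasakian with respect to $g$ if, for all $\alpha$ and all vector fields $X,Y$, $$g(\phi_\alpha X,\phi_\alpha Y)=\epsilon_\alpha g(X,Y)-\eta_\alpha(X)\eta_\alpha(Y),\qquad g(X,\xi_\alpha)=\eta_\alpha(X),$$ $$(\nabla_X\phi_1)Y=g(X,Y)\xi_1-\eta_1(Y)X,$$ $$(\nabla_X\phi_\alpha)Y=-\bigl(g(\phi_\alpha X,\phi_\alpha Y)\xi_\alpha+\eta_\alpha(Y)\phi_\alpha^2X\bigr)\qquad(\alpha=2,3).$$ A vector field $X$ is Killing if $L_Xg=0$. For $p\ge1$, a conformal Killing–Yano tensor of rank $p$ is a smooth $p$-form $\omega$ such that, for every vector field $X$, $$\nabla_X\omega=\frac1{p+1}\,X\lrcorner d\omega-\frac1{m-p+1}\,X^*\wedge d^*\omega,$$ where $X^*=g(X,\cdot)$ and $d^*\omega=-\sum_i e^i\lrcorner\nabla_{e_i}\omega$ is the codifferential of $g$ ($(e_i)$ a local frame, $(e^i)$ its $g$-dual frame). It is a Killing–Yano tensor if moreover $d^*\omega=0$, and it is strictly conformal if it is not a Killing–Yano tensor. Suppose that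 $M$ carries a mixed 3-Sasakian structure with respect to $g$. Then: (i) $\xi_1,\xi_2,\xi_3$ are Killing vector fields, with $g(\xi_1,\xi_1)=1$ (unit spacelike) and $g(\xi_2,\xi_2)=g(\xi_3,\xi_3)=-1$ (unit timelike). (ii) $\eta_1,\eta_2,\eta_3$ are conformal Killing–Yano tensors of rank $1$. (iii) $d\eta_1,d\eta_2,d\eta_3$ are strictly conformal Killing–Yano tensors of rank $2$. (iv) For every $k\in\{0,1,\dots,2n+1\}$, every linear combination with real coefficients of $\eta_1\wedge(d\eta_1)^k$, $\eta_2\wedge(d\eta_2)^k$, $\eta_3\wedge(d\eta_3)^k$ is a Killing–Yano tensor of rank $2k+1$; and $M$ admits a Killing–Yano tensor of rank $2k+1$ that is not identically zero. -/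

import Mathlib

open scoped Manifold ContDiff Topology

noncomputable section

namespace MixedSasaki

/-! Throughout, `M` is a smooth manifold (without boundary) modelled on a finite-dimensional real
vector space `E`.  Statements about vector fields are made germwise: "`Y` smooth at `x`" is enough,
because every expression below depends only on germs of vector fields. -/

section Forms

variable (E : Type*) [NormedAddCommGroup E] [NormedSpace ℝ E]
  (M : Type*) [TopologicalSpace M] [ChartedSpace E M] [IsManifold 𝓘(ℝ, E) ∞ M]

/-- (Not necessarily smooth) differential `p`-forms on `M`. -/
abbrev Form (p : ℕ) : Type _ := Π x : M, TangentSpace 𝓘(ℝ, E) x [⋀^Fin p]→L[ℝ] ℝ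

/-- Vector fields on `M` (no smoothness imposed). -/
abbrev VField : Type _ := Π x : M, TangentSpace 𝓘(ℝ, E) x

variable {E M}

/-- A form is smooth if its value on smooth vector fields is a smooth function. -/
def IsSmoothForm {p : ℕ} (θ : Form E M p) : Prop :=
  ∀ (x : M) (Y : Fin p → VField E M),
    (∀ i, ContMDiffAt 𝓘(ℝ, E) (𝓘(ℝ, E).prod 𝓘(ℝ, E)) ∞ (T% (Y i)) x) →
    ContMDiffAt 𝓘(ℝ, E) 𝓘(ℝ, ℝ) ∞ (fun y ↦ θ y (fun i ↦ Y i y)) x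

/-- A covector field, seen as a `1`-form. -/
def oneForm (η : Π x : M, TangentSpace 𝓘(ℝ, E) x →L[ℝ] ℝ) : Form E M 1 :=
  fun x ↦ ContinuousAlternatingMap.ofSubsingleton ℝ (TangentSpace 𝓘(ℝ, E) x) ℝ (0 : Fin 1) (η x)

/-- The expression of the form `θ` in the chart at `x`, that is, its pullback under the inverse of
that chart. -/
def chartRep {p : ℕ} (θ : Form E M p) (x : M) : E → E [⋀^Fin p]→L[ℝ] ℝ :=
  fun y ↦ (θ ((extChartAt 𝓘(ℝ, E) x).symm y)).compContinuousLinearMap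
    (mfderiv 𝓘(ℝ, E) 𝓘(ℝ, E) (extChartAt 𝓘(ℝ, E) x).symm y)

/-- The exterior derivative: at `x`, it is computed in the chart at `x`.  The normalization is
`dη(X, Y) = X (η Y) - Y (η X) - η [X, Y]` for `1`-forms. -/
def extD {p : ℕ} (θ : Form E M p) : Form E M (p + 1) :=
  fun x ↦ (extDeriv (chartRep θ x) (extChartAt 𝓘(ℝ, E) x x)).compContinuousLinearMap
    (mfderiv 𝓘(ℝ, E) 𝓘(ℝ, E) (extChartAt 𝓘(ℝ, E) x) x)

/-- An alternating map on a finite-dimensional space, as a continuous alternating map. -/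
def toContAlt {V : Type*} [AddCommGroup V] [Module ℝ V] [TopologicalSpace V]
    [IsTopologicalAddGroup V] [ContinuousSMul ℝ V] [T2Space V] [FiniteDimensional ℝ V] {p : ℕ}
    (f : V [⋀^Fin p]→ₗ[ℝ] ℝ) : V [⋀^Fin p]→L[ℝ] ℝ :=
  { f with
    cont := by
      have h : ∀ v : Fin p → V, f v = ∑ r : Fin p → Fin (Module.finrank ℝ V),
          (∏ i, (Module.finBasis ℝ V).repr (v i) (r i)) •
            f (fun i ↦ Module.finBasis ℝ V (r i)) := by
        intro v
        conv_lhs => rw [show v = fun i ↦ ∑ j, (Module.finBasis ℝ V).repr (v i) j •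
          Module.finBasis ℝ V j from funext fun i ↦ ((Module.finBasis ℝ V).sum_repr (v i)).symm]
        rw [← AlternatingMap.coe_multilinearMap, MultilinearMap.map_sum]
        exact Finset.sum_congr rfl fun r _ ↦ MultilinearMap.map_smul_univ _ _ _
      change Continuous fun v : Fin p → V ↦ f v
      rw [show (fun v : Fin p → V ↦ f v) = _ from funext h]
      simp only [smul_eq_mul]
      refine continuous_finsetSum _ fun r _ ↦
        (continuous_finsetProd _ fun i _ ↦ ?_).mul continuous_const
      exact ((Module.finBasis ℝ V).coord (r i)).continuous_of_finiteDimensional.comp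
        (continuous_apply i) }

variable [FiniteDimensional ℝ E]

instance tangentFiniteDimensional (x : M) : FiniteDimensional ℝ (TangentSpace 𝓘(ℝ, E) x) :=
  inferInstanceAs (FiniteDimensional ℝ E)

instance tangentT2Space (x : M) : T2Space (TangentSpace 𝓘(ℝ, E) x) :=
  inferInstanceAs (T2Space E)

/-- The wedge product of a `p`-form and a `q`-form, as a form of degree `r = p + q`: the signed sum
over all `(p, q)`-shuffles, so that `(α ∧ β)(X, Y) = α X * β Y - α Y * β X` for `1`-forms. -/
def wedge {p q r : ℕ} (h : p + q = r) (α : Form E M p) (β : Form E M q) : Form E M r :=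
  fun x ↦ toContAlt <|
    ((LinearMap.mul' ℝ ℝ).compAlternatingMap
      ((α x).toAlternatingMap.domCoprod (β x).toAlternatingMap)).domDomCongr
        (finSumFinEquiv.trans (finCongr h))

/-- The `k`-fold wedge power `θ ∧ ⋯ ∧ θ` of a `2`-form; the `0`-th power is the function `1`. -/
def wedgePow (θ : Form E M 2) : (k : ℕ) → Form E M (2 * k)
  | 0 => fun x ↦ ContinuousAlternatingMap.constOfIsEmpty ℝ (TangentSpace 𝓘(ℝ, E) x) (Fin 0) 1
  | k + 1 => wedge (by omega) (wedgePow θ k) θ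

/-- The form `η ∧ (dη)^k` of degree `2k + 1`. -/
def contactForm (η : Form E M 1) (k : ℕ) : Form E M (2 * k + 1) :=
  wedge (by omega) η (wedgePow (extD η) k)

end Forms

section Metric

variable (E : Type*) [NormedAddCommGroup E] [NormedSpace ℝ E]
  (M : Type*) [TopologicalSpace M] [ChartedSpace E M] [IsManifold 𝓘(ℝ, E) ∞ M]

/-- A semi-Riemannian metric: a smooth field of nondegenerate symmetric bilinear forms on the
tangent spaces.  (The index is not required to be constant here; it is automatically so on a
connected manifold, and for metrics compatible with a mixed 3-structure.) -/
structure SemiRiemannianMetric where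
  /-- the bilinear form `g x` on the tangent space at `x` -/
  val (x : M) : TangentSpace 𝓘(ℝ, E) x →L[ℝ] TangentSpace 𝓘(ℝ, E) x →L[ℝ] ℝ
  symm (x : M) (v w : TangentSpace 𝓘(ℝ, E) x) : val x v w = val x w v
  nondeg (x : M) (v : TangentSpace 𝓘(ℝ, E) x) : (∀ w, val x v w = 0) → v = 0
  smooth : ContMDiff 𝓘(ℝ, E) (𝓘(ℝ, E).prod 𝓘(ℝ, E →L[ℝ] E →L[ℝ] ℝ)) ∞
    (fun x ↦ Bundle.TotalSpace.mk' (E →L[ℝ] E →L[ℝ] ℝ)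
      (E := fun y : M ↦ TangentSpace 𝓘(ℝ, E) y →L[ℝ] TangentSpace 𝓘(ℝ, E) y →L[ℝ] ℝ) x (val x))

variable {E M}

namespace SemiRiemannianMetric

/-- The metric at `x` as an algebraic bilinear form. -/
def bilin (g : SemiRiemannianMetric E M) (x : M) :
    LinearMap.BilinForm ℝ (TangentSpace 𝓘(ℝ, E) x) :=
  (ContinuousLinearMap.coeLM ℝ).comp (g.val x).toLinearMap

theorem bilin_apply (g : SemiRiemannianMetric E M) (x : M) (v w : TangentSpace 𝓘(ℝ, E) x) :
    g.bilin x v w = g.val x v w := rfl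

theorem bilin_nondegenerate (g : SemiRiemannianMetric E M) (x : M) :
    (g.bilin x).Nondegenerate :=
  ⟨fun v h ↦ g.nondeg x v fun w ↦ h w,
    fun v h ↦ g.nondeg x v fun w ↦ (g.symm x v w).trans (h w)⟩

end SemiRiemannianMetric

/-- `X` is a Killing field: `X` is smooth and the Lie derivative
`(L_X g)(Y, Z) = X (g(Y, Z)) - g([X, Y], Z) - g(Y, [X, Z])` vanishes. -/
def IsKillingField (g : SemiRiemannianMetric E M) (X : VField E M) : Prop :=
  ContMDiff 𝓘(ℝ, E) (𝓘(ℝ, E).prod 𝓘(ℝ, E)) ∞ (T% X) ∧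
  ∀ (x : M) (Y Z : VField E M),
    ContMDiffAt 𝓘(ℝ, E) (𝓘(ℝ, E).prod 𝓘(ℝ, E)) ∞ (T% Y) x →
    ContMDiffAt 𝓘(ℝ, E) (𝓘(ℝ, E).prod 𝓘(ℝ, E)) ∞ (T% Z) x →
    mvfderiv 𝓘(ℝ, E) (fun y ↦ g.val y (Y y) (Z y)) x (X x)
      - g.val x (VectorField.mlieBracket 𝓘(ℝ, E) X Y x) (Z x)
      - g.val x (Y x) (VectorField.mlieBracket 𝓘(ℝ, E) X Z x) = 0

variable [FiniteDimensional ℝ E]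

variable (E M) in
/-- Affine connections on `M`.  In Mathlib's notation `∇ Y x v` is `(∇_v Y)(x)`. -/
abbrev Connection : Type _ := CovariantDerivative 𝓘(ℝ, E) E (TangentSpace 𝓘(ℝ, E) : M → Type _)

/-- `∇` is the Levi-Civita connection of `g`: it is torsion-free, `∇_X Y - ∇_Y X = [X, Y]`, and
metric, `X (g(Y, Z)) = g(∇_X Y, Z) + g(Y, ∇_X Z)`.  These two conditions have exactly one solution
`∇` on differentiable fields. -/
structure IsLeviCivita (g : SemiRiemannianMetric E M) (nabla : Connection E M) : Prop where
  torsion_free : ∀ (x : M) (X Y : VField E M),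
    MDifferentiableAt 𝓘(ℝ, E) (𝓘(ℝ, E).prod 𝓘(ℝ, E)) (T% X) x →
    MDifferentiableAt 𝓘(ℝ, E) (𝓘(ℝ, E).prod 𝓘(ℝ, E)) (T% Y) x →
    nabla Y x (X x) - nabla X x (Y x) = VectorField.mlieBracket 𝓘(ℝ, E) X Y x
  metric : ∀ (x : M) (v : TangentSpace 𝓘(ℝ, E) x) (Y Z : VField E M),
    MDifferentiableAt 𝓘(ℝ, E) (𝓘(ℝ, E).prod 𝓘(ℝ, E)) (T% Y) x →
    MDifferentiableAt 𝓘(ℝ, E) (𝓘(ℝ, E).prod 𝓘(ℝ, E)) (T% Z) x →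
    mvfderiv 𝓘(ℝ, E) (fun y ↦ g.val y (Y y) (Z y)) x v
      = g.val x (nabla Y x v) (Z x) + g.val x (Y x) (nabla Z x v)

/-- The covariant derivative of a `p`-form,
`(∇_v θ)(w₁, …, w_p) = v (θ(W₁, …, W_p)) - ∑ i, θ(w₁, …, ∇_v W_i, …, w_p)`,
where `W_i` is a local field, smooth near `x`, with `W_i x = w_i`.  For smooth `θ` the result does
not depend on the choice of these fields. -/
def covDerivForm (nabla : Connection E M) {p : ℕ} (θ : Form E M p) (x : M)
    (v : TangentSpace 𝓘(ℝ, E) x) (w : Fin p → TangentSpace 𝓘(ℝ, E) x) : ℝ :=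
  mvfderiv 𝓘(ℝ, E) (fun y ↦ θ y (fun i ↦ FiberBundle.extend E (w i) y)) x v
    - ∑ i, θ x (Function.update w i (nabla (FiberBundle.extend E (w i)) x v))

/-- The codifferential `d^*` (the formal adjoint of `d` with respect to `g`),
`d^*θ = - ∑ i, e^i ⌟ ∇_{e_i} θ`, that is, in index notation,
`(d^*θ)_{j₂ … j_p} = - g^{ij} ∇_i θ_{j j₂ … j_p}`.
Here `e_i` is a basis of the tangent space and `e^i` is its `g`-dual basis, `g(e^i, e_j) = δ_ij`;
the value does not depend on the basis. -/
def codiff (g : SemiRiemannianMetric E M) (nabla : Connection E M) {p : ℕ}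
    (θ : Form E M (p + 1)) (x : M) (w : Fin p → TangentSpace 𝓘(ℝ, E) x) : ℝ :=
  - ∑ i, covDerivForm nabla θ x
      (Module.finBasis ℝ (TangentSpace 𝓘(ℝ, E) x) i)
      (Fin.cons ((g.bilin x).dualBasis (g.bilin_nondegenerate x)
        (Module.finBasis ℝ (TangentSpace 𝓘(ℝ, E) x)) i) w)

/-- `(X^* ∧ β)(w₀, …, w_p) = ∑ i, (-1)^i g(X, w_i) β(w₀, …, ŵ_i, …, w_p)`, where `X^*` is the
`1`-form `g`-dual to `X`. -/
def dualWedge (g : SemiRiemannianMetric E M) {p : ℕ} (x : M) (X : TangentSpace 𝓘(ℝ, E) x)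
    (β : (Fin p → TangentSpace 𝓘(ℝ, E) x) → ℝ) (w : Fin (p + 1) → TangentSpace 𝓘(ℝ, E) x) : ℝ :=
  ∑ i : Fin (p + 1), (-1 : ℝ) ^ (i : ℕ) * g.val x X (w i) * β (i.removeNth w)

/-- A conformal Killing-Yano tensor of rank `r = p + 1 ≥ 1` on a manifold of dimension `m`: a
smooth `r`-form `θ` with `∇_X θ = 1/(r+1) X ⌟ dθ - 1/(m-r+1) X^* ∧ d^*θ`. -/
def IsConformalKillingYano (g : SemiRiemannianMetric E M) (nabla : Connection E M) {p : ℕ}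
    (θ : Form E M (p + 1)) : Prop :=
  IsSmoothForm θ ∧
  ∀ (x : M) (X : TangentSpace 𝓘(ℝ, E) x) (w : Fin (p + 1) → TangentSpace 𝓘(ℝ, E) x),
    covDerivForm nabla θ x X w
      = 1 / (((p + 1 : ℕ) : ℝ) + 1) * extD θ x (Fin.cons X w)
        - 1 / ((Module.finrank ℝ E : ℝ) - ((p + 1 : ℕ) : ℝ) + 1)
          * dualWedge g x X (codiff g nabla θ x) w

/-- A Killing-Yano tensor: a co-closed conformal Killing-Yano tensor. -/
def IsKillingYano (g : SemiRiemannianMetric E M) (nabla : Connection E M) {p : ℕ}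
    (θ : Form E M (p + 1)) : Prop :=
  IsConformalKillingYano g nabla θ ∧ ∀ x w, codiff g nabla θ x w = 0

/-- A strictly conformal Killing-Yano tensor: conformal Killing-Yano, but not Killing-Yano. -/
def IsStrictlyConformalKillingYano (g : SemiRiemannianMetric E M) (nabla : Connection E M) {p : ℕ}
    (θ : Form E M (p + 1)) : Prop :=
  IsConformalKillingYano g nabla θ ∧ ¬ IsKillingYano g nabla θ

/-- The signs `ε₁ = 1`, `ε₂ = ε₃ = -1`, indexed by `0, 1, 2`. -/
def eps : Fin 3 → ℝ := ![1, -1, -1]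

variable (E M) in
/-- A mixed 3-structure: an almost contact structure (index `0`) and two almost paracontact
structures (indices `1`, `2`) satisfying compatibility relations.  The even permutations
`(α, β, γ)` of the indices are the triples `(α, α + 1, α + 2)` computed modulo `3`. -/
structure MixedThreeStructure where
  /-- the fields of endomorphisms -/
  φ (α : Fin 3) (x : M) : TangentSpace 𝓘(ℝ, E) x →L[ℝ] TangentSpace 𝓘(ℝ, E) x
  /-- the vector fields -/
  ξ (α : Fin 3) (x : M) : TangentSpace 𝓘(ℝ, E) x
  /-- the `1`-forms -/
  η (α : Fin 3) (x : M) : TangentSpace 𝓘(ℝ, E) x →L[ℝ] ℝ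
  φ_smooth : ∀ α, ContMDiff 𝓘(ℝ, E) (𝓘(ℝ, E).prod 𝓘(ℝ, E →L[ℝ] E)) ∞
    (fun x ↦ Bundle.TotalSpace.mk' (E →L[ℝ] E)
      (E := fun y : M ↦ TangentSpace 𝓘(ℝ, E) y →L[ℝ] TangentSpace 𝓘(ℝ, E) y) x (φ α x))
  ξ_smooth : ∀ α, ContMDiff 𝓘(ℝ, E) (𝓘(ℝ, E).prod 𝓘(ℝ, E)) ∞ (T% (ξ α))
  η_smooth : ∀ α, IsSmoothForm (oneForm (η α))
  φ_sq : ∀ α x v, φ α x (φ α x v) = - (eps α • v) + η α x v • ξ α x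
  η_ξ_self : ∀ α x, η α x (ξ α x) = eps α
  η_ξ : ∀ α β, α ≠ β → ∀ x, η α x (ξ β x) = 0
  φ_ξ : ∀ α x, φ α x (ξ (α + 1) x) = eps (α + 2) • ξ (α + 2) x
  φ_ξ' : ∀ α x, - φ (α + 1) x (ξ α x) = eps (α + 2) • ξ (α + 2) x
  η_φ : ∀ α x v, η α x (φ (α + 1) x v) = eps (α + 2) * η (α + 2) x v
  η_φ' : ∀ α x v, - η (α + 1) x (φ α x v) = eps (α + 2) * η (α + 2) x v
  φ_φ : ∀ α x v, φ α x (φ (α + 1) x v) - η (α + 1) x v • ξ α x = eps (α + 2) • φ (α + 2) x v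
  φ_φ' : ∀ α x v, - φ (α + 1) x (φ α x v) + η α x v • ξ (α + 1) x
    = eps (α + 2) • φ (α + 2) x v

/-- The metric `g` is compatible with the mixed 3-structure. -/
structure IsCompatibleMetric (g : SemiRiemannianMetric E M) (S : MixedThreeStructure E M) :
    Prop where
  φ_φ : ∀ α x v w, g.val x (S.φ α x v) (S.φ α x w)
    = eps α * g.val x v w - S.η α x v * S.η α x w
  ξ_dual : ∀ α x v, g.val x v (S.ξ α x) = S.η α x v

/-- The covariant derivative of a field of endomorphisms,
`(∇_v φ) Y = ∇_v (φ Y) - φ (∇_v Y)`, evaluated on the vector field `Y`. -/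
def covDerivEnd (nabla : Connection E M)
    (φ : Π x : M, TangentSpace 𝓘(ℝ, E) x →L[ℝ] TangentSpace 𝓘(ℝ, E) x) (x : M)
    (v : TangentSpace 𝓘(ℝ, E) x) (Y : VField E M) : TangentSpace 𝓘(ℝ, E) x :=
  nabla (fun y ↦ φ y (Y y)) x v - φ x (nabla Y x v)

/-- A mixed 3-Sasakian structure: a mixed 3-structure with a compatible metric whose first
structure is Sasakian and whose other two structures are (Lorentzian para-)Sasakian.  The overall
sign in `lp_sasakian` is the one for which the three conditions are consistent with the relations of
a mixed 3-structure; with it each of them reads `(∇_X φ) Y = g(X, Y) ξ - η(Y) X`. -/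
structure IsMixedThreeSasakian (g : SemiRiemannianMetric E M) (nabla : Connection E M)
    (S : MixedThreeStructure E M) : Prop extends IsCompatibleMetric g S where
  sasakian : ∀ (x : M) (v : TangentSpace 𝓘(ℝ, E) x) (Y : VField E M),
    ContMDiffAt 𝓘(ℝ, E) (𝓘(ℝ, E).prod 𝓘(ℝ, E)) ∞ (T% Y) x →
    covDerivEnd nabla (S.φ 0) x v Y = g.val x v (Y x) • S.ξ 0 x - S.η 0 x (Y x) • v
  lp_sasakian : ∀ α : Fin 3, α ≠ 0 →
    ∀ (x : M) (v : TangentSpace 𝓘(ℝ, E) x) (Y : VField E M),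
    ContMDiffAt 𝓘(ℝ, E) (𝓘(ℝ, E).prod 𝓘(ℝ, E)) ∞ (T% Y) x →
    covDerivEnd nabla (S.φ α) x v Y
      = - (g.val x (S.φ α x v) (S.φ α x (Y x)) • S.ξ α x
          + S.η α x (Y x) • S.φ α x (S.φ α x v))

end Metric

end MixedSasaki

end

/-! Write m for the dimension, ω = dη_α and v* = g(v, ·). With the chosen signs all three structures
satisfy (∇_v φ)Y = g(v, Y)ξ − η(Y)v (`covDerivEnd_phi`). Taking Y = ξ gives ∇_v ξ = −φv
(`nabla_xi`). Since φ is g-skew, ξ is Killing. It also follows that ∇_v η = ½ v⌟ω, that ω(v, w) =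
2g(v, φw), and that ∇_v ω = 2 η ∧ v*.

A form whose covariant derivative is totally skew is Killing–Yano (`isKillingYano_of_alternating`):
dθ is then a multiple of ∇θ, and the metric trace of a skew tensor is zero. In ∇_v(η ∧ ω^k) the
terms that differentiate ω contain η ∧ η, so they vanish. What remains is ½ (v⌟ω) ∧ ω^k = v⌟ω^(k+1)
/ (2(k+1)), which is totally skew (`covDerivForm_contactForm`). The property is linear, so sums over
α are covered.

For ω itself, dω = 0 and d*ω = 2(m − 1)η. The conformal equation then holds, and d*ω does not vanish
on ξ. Finally, ω is nondegenerate on ker η, so ω^k ≠ 0 while 2k ≤ m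
(`onLists_wedgePow_extD_eta_ne_zero`); contracting η ∧ ω^k with ξ returns ±ω^k, so that form is
nonzero too.

The exterior algebra is carried out on functions of lists, where degrees need no casts and each
identity is an induction on the first argument. `onLists_algWedge` identifies the wedge product with
the shuffle product, and `extD_eq_sum_covDerivForm` expresses d through ∇. -/

noncomputable section

namespace MixedSasaki

/-! ### The signed shuffle algebra of functions on lists -/

section Shuffle

variable {V : Type*}

/-- Insertion of `v` as the first argument. -/
def ins (a : List V → ℝ) (v : V) : List V → ℝ := fun l ↦ a (v :: l)

/-- The grading involution. -/
def bar (a : List V → ℝ) : List V → ℝ := fun l ↦ (-1) ^ l.length * a l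

/-- The signed shuffle product: the product for which insertions are antiderivations. -/
def shuffle : (List V → ℝ) → (List V → ℝ) → List V → ℝ
  | a, b, [] => a [] * b []
  | a, b, v :: l => shuffle (ins a v) b l + shuffle (bar a) (ins b v) l

/-- The unit of the shuffle product. -/
def unitFun : List V → ℝ
  | [] => 1
  | _ :: _ => 0

local infixl:70 " ⋏ " => shuffle

theorem shuffle_nil (a b : List V → ℝ) : (a ⋏ b) [] = a [] * b [] := rfl

theorem shuffle_cons (a b : List V → ℝ) (v : V) (l : List V) :
    (a ⋏ b) (v :: l) = (ins a v ⋏ b) l + (bar a ⋏ ins b v) l := rfl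

theorem ins_shuffle (a b : List V → ℝ) (v : V) :
    ins (a ⋏ b) v = ins a v ⋏ b + bar a ⋏ ins b v := rfl

theorem bar_bar (a : List V → ℝ) : bar (bar a) = a := by
  funext l
  simp only [bar, ← mul_assoc, ← mul_pow]
  simp

theorem ins_bar (a : List V → ℝ) (v : V) : ins (bar a) v = -bar (ins a v) := by
  funext l
  simp [ins, bar, pow_succ]

theorem ins_add (a b : List V → ℝ) (v : V) : ins (a + b) v = ins a v + ins b v := rfl

theorem ins_smul (c : ℝ) (a : List V → ℝ) (v : V) : ins (c • a) v = c • ins a v := rfl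

theorem ins_zero (v : V) : ins (0 : List V → ℝ) v = 0 := rfl

theorem bar_add (a b : List V → ℝ) : bar (a + b) = bar a + bar b := by
  funext l; simp [bar, mul_add]

theorem bar_smul (c : ℝ) (a : List V → ℝ) : bar (c • a) = c • bar a := by
  funext l; simp [bar]; ring

theorem shuffle_add_left (a a' b : List V → ℝ) : (a + a') ⋏ b = a ⋏ b + a' ⋏ b := by
  funext l
  induction l generalizing a a' b with
  | nil => simp [shuffle_nil, add_mul]
  | cons v l ih =>
    simp only [shuffle_cons, Pi.add_apply, ins_add, bar_add, ih]
    ring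

theorem shuffle_add_right (a b b' : List V → ℝ) : a ⋏ (b + b') = a ⋏ b + a ⋏ b' := by
  funext l
  induction l generalizing a b b' with
  | nil => simp [shuffle_nil, mul_add]
  | cons v l ih =>
    simp only [shuffle_cons, Pi.add_apply, ins_add, ih]
    ring

theorem shuffle_smul_left (c : ℝ) (a b : List V → ℝ) : (c • a) ⋏ b = c • (a ⋏ b) := by
  funext l
  induction l generalizing a b with
  | nil => simp [shuffle_nil, mul_assoc]
  | cons v l ih =>
    simp only [shuffle_cons, Pi.smul_apply, ins_smul, bar_smul, ih, smul_add]

theorem shuffle_smul_right (c : ℝ) (a b : List V → ℝ) : a ⋏ (c • b) = c • (a ⋏ b) := by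
  funext l
  induction l generalizing a b with
  | nil => simp [shuffle_nil, mul_left_comm]
  | cons v l ih =>
    simp only [shuffle_cons, Pi.smul_apply, ins_smul, ih, smul_add]

theorem shuffle_neg_left (a b : List V → ℝ) : (-a) ⋏ b = -(a ⋏ b) := by
  simpa using shuffle_smul_left (-1) a b

theorem shuffle_neg_right (a b : List V → ℝ) : a ⋏ (-b) = -(a ⋏ b) := by
  simpa using shuffle_smul_right (-1) a b

theorem shuffle_zero_left (b : List V → ℝ) : 0 ⋏ b = 0 := by
  simpa using shuffle_smul_left 0 0 b

theorem shuffle_zero_right (a : List V → ℝ) : a ⋏ 0 = 0 := by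
  simpa using shuffle_smul_right 0 a 0

theorem bar_shuffle (a b : List V → ℝ) : bar (a ⋏ b) = bar a ⋏ bar b := by
  funext l
  induction l generalizing a b with
  | nil => simp [shuffle_nil, bar]
  | cons v l ih =>
    change ins (bar (a ⋏ b)) v l = _
    rw [ins_bar, ins_shuffle, shuffle_cons, ins_bar, ins_bar, shuffle_neg_left, shuffle_neg_right,
      bar_add, Pi.neg_apply, Pi.add_apply, ih, ih, Pi.neg_apply, Pi.neg_apply]
    ring

theorem shuffle_assoc (a b c : List V → ℝ) : a ⋏ b ⋏ c = a ⋏ (b ⋏ c) := by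
  funext l
  induction l generalizing a b c with
  | nil => simp [shuffle_nil, mul_assoc]
  | cons v l ih =>
    rw [shuffle_cons, shuffle_cons, ins_shuffle, ins_shuffle, bar_shuffle, shuffle_add_left,
      shuffle_add_right, Pi.add_apply, Pi.add_apply, ih, ih, ih, add_assoc]

/-- Insertion reverses parity, so the even and odd cases feed each other and have to go through one
induction. -/
theorem shuffle_comm_aux (l : List V) (a b : List V → ℝ) :
    (bar b = b → (a ⋏ b) l = (b ⋏ a) l) ∧ (bar b = -b → (b ⋏ a) l = (bar a ⋏ b) l) := by
  induction l generalizing a b with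
  | nil =>
    refine ⟨fun _ ↦ by simp [shuffle_nil, mul_comm], fun h ↦ ?_⟩
    simp [shuffle_nil, bar, mul_comm]
  | cons v l ih =>
    refine ⟨fun h ↦ ?_, fun h ↦ ?_⟩
    · have h' : bar (ins b v) = -ins b v := by
        rw [← neg_eq_iff_eq_neg, ← ins_bar, h]
      rw [shuffle_cons, shuffle_cons, (ih (ins a v) b).1 h, (ih a (ins b v)).2 h', h, add_comm]
    · have h' : bar (ins b v) = ins b v := by
        rw [← neg_inj, ← ins_bar, h]; rfl
      rw [shuffle_cons, shuffle_cons, ins_bar, bar_bar, h, shuffle_neg_left, shuffle_neg_left,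
        Pi.neg_apply, Pi.neg_apply, (ih (ins a v) b).2 h, (ih a (ins b v)).1 h', add_comm]

theorem shuffle_comm_of_even (a : List V → ℝ) {b : List V → ℝ} (h : bar b = b) :
    a ⋏ b = b ⋏ a :=
  funext fun l ↦ (shuffle_comm_aux l a b).1 h

theorem shuffle_comm_of_odd (a : List V → ℝ) {b : List V → ℝ} (h : bar b = -b) :
    b ⋏ a = bar a ⋏ b :=
  funext fun l ↦ (shuffle_comm_aux l a b).2 h

theorem shuffle_self_of_odd {a : List V → ℝ} (h : bar a = -a) : a ⋏ a = 0 := by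
  have := shuffle_comm_of_odd a h
  rw [h, shuffle_neg_left] at this
  exact self_eq_neg.1 this

theorem ins_unitFun (v : V) : ins (unitFun : List V → ℝ) v = 0 := rfl

theorem bar_unitFun : bar (unitFun : List V → ℝ) = unitFun := by
  funext l
  cases l <;> simp [bar, unitFun]

theorem unitFun_shuffle (a : List V → ℝ) : unitFun ⋏ a = a := by
  funext l
  induction l generalizing a with
  | nil => simp [shuffle_nil, unitFun]
  | cons v l ih =>
    rw [shuffle_cons, ins_unitFun, bar_unitFun, shuffle_zero_left, ih]
    simp [ins]

theorem shuffle_unitFun (a : List V → ℝ) : a ⋏ unitFun = a := by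
  rw [shuffle_comm_of_even a bar_unitFun, unitFun_shuffle]

/-- The derivation of the shuffle algebra that replaces one argument `v` by `T v`. -/
def der (T : V → V) : (List V → ℝ) → List V → ℝ
  | _, [] => 0
  | a, v :: l => a (T v :: l) + der T (ins a v) l

theorem ins_der (T : V → V) (a : List V → ℝ) (v : V) :
    ins (der T a) v = ins a (T v) + der T (ins a v) := rfl

theorem der_add (T : V → V) (a b : List V → ℝ) : der T (a + b) = der T a + der T b := by
  funext l
  induction l generalizing a b with
  | nil => simp [der]
  | cons v l ih =>
    simp only [der, Pi.add_apply, ins_add, ih]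
    ring

theorem der_smul (T : V → V) (c : ℝ) (a : List V → ℝ) : der T (c • a) = c • der T a := by
  funext l
  induction l generalizing a with
  | nil => simp [der]
  | cons v l ih =>
    simp only [der, Pi.smul_apply, ins_smul, ih, smul_add]

theorem bar_der (T : V → V) (a : List V → ℝ) : bar (der T a) = der T (bar a) := by
  funext l
  induction l generalizing a with
  | nil => simp [der, bar]
  | cons v l ih =>
    change ins (bar (der T a)) v l = _
    rw [ins_bar, ins_der, bar_add, Pi.neg_apply, Pi.add_apply, ih, der, ins_bar, show -bar (ins a v) = (-1 : ℝ) • bar (ins a v)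
      by simp, der_smul]
    simp [bar, ins, pow_succ]
    ring

/-- No linearity of `T` is needed. In `covList_wedge` this makes the correction terms θ(…, ∇_v W_i,
…) of a product split between its factors. -/
theorem der_shuffle (T : V → V) (a b : List V → ℝ) :
    der T (a ⋏ b) = der T a ⋏ b + a ⋏ der T b := by
  funext l
  induction l generalizing a b with
  | nil => simp [der, shuffle_nil]
  | cons v l ih =>
    rw [der, ins_shuffle, der_add, Pi.add_apply, ih, ih, shuffle_cons, Pi.add_apply (der T a ⋏ b),
      shuffle_cons, shuffle_cons, ins_der, ins_der, bar_der, shuffle_add_left, shuffle_add_right]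
    simp only [Pi.add_apply]
    ring

/-- `a` is homogeneous of degree `p`: it vanishes on lists of length different from `p`. -/
def HasDegree (a : List V → ℝ) (p : ℕ) : Prop := ∀ l : List V, l.length ≠ p → a l = 0

theorem HasDegree.ins {a : List V → ℝ} {p : ℕ} (h : HasDegree a (p + 1)) (v : V) :
    HasDegree (ins a v) p := fun l hl ↦ h _ (by simpa using hl)

theorem HasDegree.ins_zero {a : List V → ℝ} (h : HasDegree a 0) (v : V) :
    MixedSasaki.ins a v = 0 := funext fun _ ↦ h _ (by simp)

theorem HasDegree.bar_eq {a : List V → ℝ} {p : ℕ} (h : HasDegree a p) :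
    bar a = (-1 : ℝ) ^ p • a := by
  funext l
  by_cases hl : l.length = p
  · simp [bar, hl]
  · simp [bar, h l hl]

theorem HasDegree.smul {a : List V → ℝ} {p : ℕ} (h : HasDegree a p) (c : ℝ) :
    HasDegree (c • a) p := fun l hl ↦ by simp [h l hl]

theorem HasDegree.shuffle {a b : List V → ℝ} {p q : ℕ} (ha : HasDegree a p) (hb : HasDegree b q) :
    HasDegree (a ⋏ b) (p + q) := by
  intro l
  induction l generalizing a b p q with
  | nil =>
    intro h
    rw [shuffle_nil]
    by_cases hp : p = 0
    · rw [hb [] (by simp at h ⊢; omega), mul_zero]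
    · rw [ha [] (by simp; omega), zero_mul]
  | cons v l ih =>
    intro h
    simp only [List.length_cons] at h
    have e1 : (MixedSasaki.ins a v ⋏ b) l = 0 := by
      cases p with
      | zero => rw [ha.ins_zero, shuffle_zero_left]; rfl
      | succ p => exact ih (ha.ins v) hb (by omega)
    have e2 : (bar a ⋏ MixedSasaki.ins b v) l = 0 := by
      cases q with
      | zero => rw [hb.ins_zero, shuffle_zero_right]; rfl
      | succ q => exact ih (ha.bar_eq ▸ ha.smul _) (hb.ins v) (by omega)
    rw [shuffle_cons, e1, e2, add_zero]

theorem HasDegree.ext {a b : List V → ℝ} {p : ℕ} (ha : HasDegree a p) (hb : HasDegree b p)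
    (h : ∀ w : Fin p → V, a (List.ofFn w) = b (List.ofFn w)) : a = b := by
  funext l
  by_cases hl : l.length = p
  · subst hl
    simpa using h l.get
  · rw [ha l hl, hb l hl]

/-- A function of `p` arguments, as a function on lists vanishing in lengths other than `p`. -/
def onLists {p : ℕ} (f : (Fin p → V) → ℝ) : List V → ℝ :=
  fun l ↦ if h : l.length = p then f (fun i ↦ l.get (i.cast h.symm)) else 0

theorem onLists_hasDegree {p : ℕ} (f : (Fin p → V) → ℝ) : HasDegree (onLists f) p :=
  fun l hl ↦ by simp [onLists, hl]

theorem onLists_ofFn {p : ℕ} (f : (Fin p → V) → ℝ) (w : Fin p → V) :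
    onLists f (List.ofFn w) = f w := by
  have : (List.ofFn w).length = p := by simp
  rw [onLists, dif_pos this]
  congr 1
  funext i
  simp

theorem ins_onLists {p : ℕ} (f : (Fin (p + 1) → V) → ℝ) (v : V) :
    ins (onLists f) v = onLists fun w ↦ f (Fin.cons v w : Fin (p + 1) → V) := by
  refine ((onLists_hasDegree f).ins v).ext (onLists_hasDegree _) fun w ↦ ?_
  rw [onLists_ofFn, ← onLists_ofFn f, List.ofFn_cons]; rfl

theorem onLists_add {p : ℕ} (f f' : (Fin p → V) → ℝ) :
    onLists (f + f') = onLists f + onLists f' := by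
  funext l
  by_cases h : l.length = p <;> simp [onLists, h]

theorem onLists_smul {p : ℕ} (c : ℝ) (f : (Fin p → V) → ℝ) :
    onLists (c • f) = c • onLists f := by
  funext l
  by_cases h : l.length = p <;> simp [onLists, h]

theorem der_hasDegree (T : V → V) {a : List V → ℝ} {p : ℕ} (h : HasDegree a p) :
    HasDegree (der T a) p := by
  intro l
  induction l generalizing a p with
  | nil => intro; rfl
  | cons v l ih =>
    intro hl
    rw [der, h _ (by simpa using hl), zero_add]
    cases p with
    | zero =>
      rw [h.ins_zero]
      have := der_smul T 0 (0 : List V → ℝ)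
      rw [zero_smul, zero_smul] at this
      rw [this]; rfl
    | succ p => exact ih (h.ins v) (by simpa using hl)

theorem der_onLists_ofFn (T : V → V) {p : ℕ} (f : (Fin p → V) → ℝ) (w : Fin p → V) :
    der T (onLists f) (List.ofFn w) = ∑ i, f (Function.update w i (T (w i))) := by
  induction p with
  | zero => simp [der]
  | succ p ih =>
    obtain ⟨v, w, rfl⟩ : ∃ v w', w = (Fin.cons v w' : Fin (p + 1) → V) :=
      ⟨w 0, Fin.tail w, (Fin.cons_self_tail w).symm⟩
    rw [List.ofFn_cons, der, ins_onLists, ih, Fin.sum_univ_succ, ← List.ofFn_cons, onLists_ofFn]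
    simp [Fin.cons_update, Fin.update_cons_zero]

theorem ins_onLists_one (f : (Fin 1 → V) → ℝ) (v : V) :
    ins (onLists f) v = f (fun _ ↦ v) • unitFun := by
  rw [ins_onLists]
  funext l
  cases l with
  | nil =>
    simp only [onLists, List.length_nil, dite_true, Pi.smul_apply, unitFun, smul_eq_mul, mul_one]
    congr 1; funext i; rw [show i = 0 from Fin.fin_one_eq_zero i]; rfl
  | cons _ _ => simp [onLists, unitFun]

/-- Expansion of the product of a `1`-form and another form. -/
theorem one_shuffle_ofFn {p : ℕ} (f : (Fin 1 → V) → ℝ) (b : List V → ℝ) (w : Fin (p + 1) → V) :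
    (onLists f ⋏ b) (List.ofFn w)
      = ∑ j : Fin (p + 1), (-1 : ℝ) ^ (j : ℕ) * f (fun _ ↦ w j) * b (List.ofFn (j.removeNth w)) := by
  induction p generalizing b with
  | zero =>
    rw [List.ofFn_succ, shuffle_cons, ins_onLists_one, shuffle_smul_left, unitFun_shuffle,
      (onLists_hasDegree f).bar_eq, List.ofFn_zero, shuffle_nil]
    simp [onLists]
  | succ p ih =>
    rw [List.ofFn_succ, shuffle_cons, ins_onLists_one, shuffle_smul_left, unitFun_shuffle,
      (onLists_hasDegree f).bar_eq, shuffle_smul_left, Pi.smul_apply, Pi.smul_apply, ih,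
      Fin.sum_univ_succ (n := p + 1)]
    congr 1
    · rw [Fin.removeNth_zero, Fin.val_zero, pow_zero, one_mul]; rfl
    · rw [smul_eq_mul, Finset.mul_sum]
      refine Finset.sum_congr rfl fun j _ ↦ ?_
      rw [List.ofFn_succ (f := (j.succ.removeNth w : Fin (p + 1) → V))]
      simp only [ins, Fin.val_succ, pow_succ]
      have : (fun i : Fin p ↦ (j.succ.removeNth w : Fin (p + 1) → V) i.succ)
          = (j.removeNth fun i ↦ w i.succ) := by
        funext i; simp [Fin.removeNth]
      rw [this]
      simp [Fin.removeNth]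

end Shuffle

/-! ### The wedge product is the shuffle product -/

section WedgeShuffle

local infixl:70 " ⋏ " => shuffle

variable {V : Type*} [AddCommGroup V] [Module ℝ V]

/-- The product of `p` covectors, as a multilinear map. -/
def covecProd {ι : Type*} [Fintype ι] (f : ι → (V →ₗ[ℝ] ℝ)) : MultilinearMap ℝ (fun _ : ι ↦ V) ℝ :=
  (MultilinearMap.mkPiAlgebra ℝ ι ℝ).compLinearMap f

/-- Determinants are the meeting point of the two products: the shuffle product builds them by
Laplace expansion, the wedge product by a sum over permutations. -/
theorem alternatization_covecProd_apply {ι : Type*} [Fintype ι] [DecidableEq ι]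
    (f : ι → (V →ₗ[ℝ] ℝ)) (w : ι → V) :
    MultilinearMap.alternatization (covecProd f) w = Matrix.det (Matrix.of fun i j ↦ f i (w j)) := by
  rw [MultilinearMap.alternatization_apply, ← Matrix.det_transpose, Matrix.det_apply]
  refine Finset.sum_congr rfl fun σ _ ↦ ?_
  simp [covecProd, MultilinearMap.domDomCongr_apply]

/-- The shuffle product of a family of covectors. -/
def covecShuffle : (p : ℕ) → (Fin p → (V →ₗ[ℝ] ℝ)) → List V → ℝ
  | 0, _ => unitFun
  | _ + 1, f => onLists (fun w : Fin 1 → V ↦ f 0 (w 0)) ⋏ covecShuffle _ (fun i ↦ f i.succ)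

/-- The expansion `one_shuffle_ofFn` is the Laplace expansion of the determinant along its first
row. -/
theorem covecShuffle_eq (p : ℕ) (f : Fin p → (V →ₗ[ℝ] ℝ)) :
    covecShuffle p f = onLists (MultilinearMap.alternatization (covecProd f)) := by
  induction p with
  | zero =>
    funext l
    cases l <;> simp [covecShuffle, unitFun, onLists, alternatization_covecProd_apply]
  | succ p ih =>
    rw [covecShuffle, ih]
    refine HasDegree.ext (p := p + 1) ?_ (onLists_hasDegree _) fun w ↦ ?_
    · have := (onLists_hasDegree fun w : Fin 1 → V ↦ f 0 (w 0)).shuffle (onLists_hasDegree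
        (MultilinearMap.alternatization (covecProd fun i ↦ f i.succ)))
      rwa [add_comm 1 p] at this
    · rw [one_shuffle_ofFn, onLists_ofFn, alternatization_covecProd_apply, Matrix.det_succ_row_zero]
      refine Finset.sum_congr rfl fun j _ ↦ ?_
      rw [onLists_ofFn, alternatization_covecProd_apply]
      rfl

theorem covecShuffle_append {p q r : ℕ} (h : p + q = r) (f : Fin p → (V →ₗ[ℝ] ℝ))
    (f' : Fin q → (V →ₗ[ℝ] ℝ)) :
    covecShuffle r (Sum.elim f f' ∘ (finSumFinEquiv.trans (finCongr h)).symm)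
      = covecShuffle p f ⋏ covecShuffle q f' := by
  induction p generalizing r with
  | zero =>
    obtain rfl : q = r := by omega
    rw [covecShuffle, unitFun_shuffle]
    congr 1
    funext i
    have : (finSumFinEquiv.trans (finCongr h)).symm i = Sum.inr i := by
      rw [Equiv.symm_apply_eq]; ext; simp
    rw [Function.comp_apply, this, Sum.elim_inr]
  | succ p ih =>
    obtain ⟨r, rfl⟩ : ∃ s, r = s + 1 := ⟨r - 1, by omega⟩
    rw [covecShuffle, covecShuffle, shuffle_assoc, ← ih (r := r) (by omega)]
    congr 2
    funext i
    obtain ⟨s, rfl⟩ := (finSumFinEquiv.trans (finCongr (show p + q = r by omega))).surjective i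
    have : (finSumFinEquiv.trans (finCongr h)).symm
        ((finSumFinEquiv.trans (finCongr (show p + q = r by omega))) s).succ
        = Sum.map Fin.succ id s := by
      rw [Equiv.symm_apply_eq]
      rcases s with s | s
      · ext; simp
      · ext; simp; omega
    simp only [Function.comp_apply, this, Equiv.symm_apply_apply]
    rcases s with s | s <;> rfl

/-- The algebraic wedge product underlying `wedge`. -/
def algWedge {p q r : ℕ} (h : p + q = r) (a : V [⋀^Fin p]→ₗ[ℝ] ℝ) (b : V [⋀^Fin q]→ₗ[ℝ] ℝ) :
    V [⋀^Fin r]→ₗ[ℝ] ℝ :=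
  ((LinearMap.mul' ℝ ℝ).compAlternatingMap (a.domCoprod b)).domDomCongr
    (finSumFinEquiv.trans (finCongr h))

/-- `algWedge` as a bilinear map. -/
def algWedgeBilin {p q r : ℕ} (h : p + q = r) :
    (V [⋀^Fin p]→ₗ[ℝ] ℝ) →ₗ[ℝ] (V [⋀^Fin q]→ₗ[ℝ] ℝ) →ₗ[ℝ] (V [⋀^Fin r]→ₗ[ℝ] ℝ) :=
  LinearMap.mk₂ ℝ (algWedge h)
    (fun a a' b ↦ by
      ext v
      simp only [algWedge, ← AlternatingMap.domCoprod'_apply, TensorProduct.add_tmul, map_add]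
      simp)
    (fun c a b ↦ by
      ext v
      simp only [algWedge, ← AlternatingMap.domCoprod'_apply, ← TensorProduct.smul_tmul', map_smul]
      simp)
    (fun a b b' ↦ by
      ext v
      simp only [algWedge, ← AlternatingMap.domCoprod'_apply, TensorProduct.tmul_add, map_add]
      simp)
    (fun c a b ↦ by
      ext v
      simp only [algWedge, ← AlternatingMap.domCoprod'_apply, TensorProduct.tmul_smul, map_smul]
      simp)

theorem algWedge_covecProd {p q r : ℕ} (h : p + q = r) (f : Fin p → (V →ₗ[ℝ] ℝ))
    (f' : Fin q → (V →ₗ[ℝ] ℝ)) :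
    algWedge h (MultilinearMap.alternatization (covecProd f))
        (MultilinearMap.alternatization (covecProd f'))
      = MultilinearMap.alternatization
        (covecProd (Sum.elim f f' ∘ (finSumFinEquiv.trans (finCongr h)).symm)) := by
  ext w
  set e := finSumFinEquiv.trans (finCongr h)
  rw [algWedge, ← MultilinearMap.domCoprod_alternization, alternatization_covecProd_apply,
    AlternatingMap.domDomCongr_apply, LinearMap.compAlternatingMap_apply,
    MultilinearMap.alternatization_apply, map_sum, ← Matrix.det_submatrix_equiv_self e,
    ← Matrix.det_transpose, Matrix.det_apply]
  refine Finset.sum_congr rfl fun σ _ ↦ ?_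
  rw [Units.smul_def, Units.smul_def, map_zsmul]
  congr 1
  simp [covecProd, MultilinearMap.domDomCongr_apply, Fintype.prod_sum_type, e]

variable [FiniteDimensional ℝ V]

/-- Expand `a` as a multilinear map in a basis and alternate: the left side becomes p! • a, and p!
is invertible in ℝ. -/
theorem alternating_eq_sum_covecProd {p : ℕ} (a : V [⋀^Fin p]→ₗ[ℝ] ℝ) :
    ∃ c : (Fin p → Fin (Module.finrank ℝ V)) → ℝ,
      a = ∑ r, c r • MultilinearMap.alternatization
          (covecProd fun i ↦ (Module.finBasis ℝ V).coord (r i)) := by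
  have h1 : (a : MultilinearMap ℝ (fun _ : Fin p ↦ V) ℝ)
      = ∑ r : Fin p → Fin (Module.finrank ℝ V), (a fun i ↦ Module.finBasis ℝ V (r i)) •
        covecProd fun i ↦ (Module.finBasis ℝ V).coord (r i) := by
    refine Module.Basis.ext_multilinear (fun _ ↦ Module.finBasis ℝ V) fun s ↦ ?_
    rw [sum_apply, Finset.sum_eq_single s]
    · simp [covecProd]
    · intro r _ hr
      obtain ⟨i, hi⟩ := Function.ne_iff.1 hr
      rw [smul_apply, covecProd, MultilinearMap.compLinearMap_apply,
        MultilinearMap.mkPiAlgebra_apply, Finset.prod_eq_zero (Finset.mem_univ i), smul_zero]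
      simp [Finsupp.single_eq_of_ne hi]
    · simp
  have h2 := AlternatingMap.coe_alternatization a
  rw [Fintype.card_fin, h1, map_sum] at h2
  have hp : (p.factorial : ℝ) ≠ 0 := by positivity
  have h3 : a = (p.factorial : ℝ)⁻¹ • (p.factorial • a) := by
    rw [← Nat.cast_smul_eq_nsmul ℝ, smul_smul, inv_mul_cancel₀ hp, one_smul]
  rw [← h2, Finset.smul_sum] at h3
  refine ⟨fun r ↦ (p.factorial : ℝ)⁻¹ * a fun i ↦ Module.finBasis ℝ V (r i), h3.trans ?_⟩
  refine Finset.sum_congr rfl fun r _ ↦ ?_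
  ext w
  simp only [MultilinearMap.alternatization_apply, mul_smul, AlternatingMap.smul_apply,
    MultilinearMap.domDomCongr_apply, smul_apply, Finset.smul_sum]
  refine Finset.sum_congr rfl fun σ _ ↦ ?_
  simp only [smul_comm (Equiv.Perm.sign σ)]

/-- `onLists` as a linear map. -/
def onListsLin (p : ℕ) : (V [⋀^Fin p]→ₗ[ℝ] ℝ) →ₗ[ℝ] (List V → ℝ) where
  toFun a := onLists a
  map_add' a b := onLists_add a b
  map_smul' c a := onLists_smul c a

/-- The shuffle product as a bilinear map. -/
def shuffleBilin (V : Type*) : (List V → ℝ) →ₗ[ℝ] (List V → ℝ) →ₗ[ℝ] (List V → ℝ) :=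
  LinearMap.mk₂ ℝ shuffle shuffle_add_left shuffle_smul_left shuffle_add_right
    fun c a b ↦ shuffle_smul_right c a b

/-- Both sides are bilinear, so products of covectors suffice, and there both are the determinant
form of the concatenated family. -/
theorem onLists_algWedge {p q r : ℕ} (h : p + q = r) (a : V [⋀^Fin p]→ₗ[ℝ] ℝ)
    (b : V [⋀^Fin q]→ₗ[ℝ] ℝ) :
    onLists (algWedge h a b) = onLists a ⋏ onLists b := by
  change onListsLin r (algWedgeBilin h a b) = shuffleBilin V (onListsLin p a) (onListsLin q b)
  obtain ⟨c, rfl⟩ := alternating_eq_sum_covecProd a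
  obtain ⟨d, rfl⟩ := alternating_eq_sum_covecProd b
  simp only [map_sum, map_smul, LinearMap.sum_apply, LinearMap.smul_apply]
  refine Finset.sum_congr rfl fun s _ ↦ ?_
  congr 1
  refine Finset.sum_congr rfl fun t _ ↦ ?_
  congr 1
  change onLists (algWedge h _ _) = onLists _ ⋏ onLists _
  rw [algWedge_covecProd, ← covecShuffle_eq, ← covecShuffle_eq, ← covecShuffle_eq,
    covecShuffle_append]

end WedgeShuffle

/-! ### Relabelling the arguments of shuffle products -/

section Shuffle

local infixl:70 " ⋏ " => shuffle

/-- When the base point moves, so does the tangent space. A fixed type `J` of labels for vector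
fields lets one list be evaluated at every point. -/
theorem shuffle_comp_map {J V : Type*} (k : J → V) (a b : List V → ℝ) :
    (fun l : List J ↦ (a ⋏ b) (l.map k)) = (fun l ↦ a (l.map k)) ⋏ fun l ↦ b (l.map k) := by
  funext l
  induction l generalizing a b with
  | nil => rfl
  | cons v l ih =>
    have h : bar (fun l : List J ↦ a (l.map k)) = fun l ↦ bar a (l.map k) := by
      funext l; simp [bar]
    rw [shuffle_cons, h]
    exact congrArg₂ (· + ·) (ih (ins a (k v)) b) (ih (bar a) (ins b (k v)))

theorem onLists_comp {J V : Type*} (k : J → V) {p : ℕ} (f : (Fin p → V) → ℝ) :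
    onLists (fun w : Fin p → J ↦ f (fun i ↦ k (w i))) = fun l ↦ onLists f (l.map k) := by
  funext l
  by_cases h : l.length = p <;> simp [onLists, h]

end Shuffle

/-! ### Derivatives of shuffle products; coordinate-constant vector fields -/

section Analysis

local infixl:70 " ⋏ " => shuffle

variable {E : Type*} [NormedAddCommGroup E] [NormedSpace ℝ E]
  {M : Type*} [TopologicalSpace M] [ChartedSpace E M]

theorem contMDiffAt_shuffle {J : Type*} {x : M} {A B : M → List J → ℝ}
    (hA : ∀ l, ContMDiffAt 𝓘(ℝ, E) 𝓘(ℝ, ℝ) ∞ (fun y ↦ A y l) x)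
    (hB : ∀ l, ContMDiffAt 𝓘(ℝ, E) 𝓘(ℝ, ℝ) ∞ (fun y ↦ B y l) x) (l : List J) :
    ContMDiffAt 𝓘(ℝ, E) 𝓘(ℝ, ℝ) ∞ (fun y ↦ (A y ⋏ B y) l) x := by
  induction l generalizing A B with
  | nil => exact (hA []).mul (hB [])
  | cons v l ih =>
    refine (ih (fun l ↦ hA (v :: l)) hB).add (ih (fun l ↦ ?_) fun l ↦ hB (v :: l))
    exact contMDiffAt_const.mul (hA l)

/-- The functions `y ↦ A y l` are differentiable at `x` with derivatives `A' l` along `v`. -/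
def HasDerivAlong {J : Type*} {x : M} (v : TangentSpace 𝓘(ℝ, E) x) (A : M → List J → ℝ)
    (A' : List J → ℝ) : Prop :=
  ∀ l, MDifferentiableAt 𝓘(ℝ, E) 𝓘(ℝ, ℝ) (fun y ↦ A y l) x ∧
    mvfderiv 𝓘(ℝ, E) (fun y ↦ A y l) x v = A' l

theorem HasDerivAlong.shuffle {J : Type*} {x : M} {v : TangentSpace 𝓘(ℝ, E) x}
    {A B : M → List J → ℝ} {A' B' : List J → ℝ}
    (hA : HasDerivAlong v A A') (hB : HasDerivAlong v B B') :
    HasDerivAlong v (fun y ↦ A y ⋏ B y) (A' ⋏ B x + A x ⋏ B') := by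
  intro l
  induction l generalizing A B A' B' with
  | nil =>
    refine ⟨(hA []).1.mul (hB []).1, ?_⟩
    have := mvfderiv_fun_mul (hA []).1 (hB []).1
    change mvfderiv 𝓘(ℝ, E) (fun y ↦ A y [] * B y []) x v = _
    rw [this]
    simp [(hA []).2, (hB []).2, shuffle_nil]
    ring
  | cons u l ih =>
    have hA1 : HasDerivAlong v (fun y ↦ ins (A y) u) (ins A' u) := fun l ↦ hA (u :: l)
    have hB1 : HasDerivAlong v (fun y ↦ ins (B y) u) (ins B' u) := fun l ↦ hB (u :: l)
    have hA2 : HasDerivAlong v (fun y ↦ bar (A y)) (bar A') := fun l ↦ by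
      refine ⟨mdifferentiableAt_const.mul (hA l).1, ?_⟩
      have := mvfderiv_fun_mul (mdifferentiableAt_const (c := (-1 : ℝ) ^ l.length)) (hA l).1
      change mvfderiv 𝓘(ℝ, E) (fun y ↦ (-1 : ℝ) ^ l.length * A y l) x v = _
      rw [this]
      simp [(hA l).2, bar, mvfderiv_const]
    obtain ⟨d1, e1⟩ := ih hA1 hB
    obtain ⟨d2, e2⟩ := ih hA2 hB1
    refine ⟨d1.add d2, ?_⟩
    change mvfderiv 𝓘(ℝ, E) (fun y ↦ (ins (A y) u ⋏ B y) l + (bar (A y) ⋏ ins (B y) u) l) x v = _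
    rw [mvfderiv_fun_add d1 d2, add_apply, e1, e2]
    simp only [Pi.add_apply, shuffle_cons]
    ring

theorem HasDerivAlong.unique {J : Type*} {x : M} {v : TangentSpace 𝓘(ℝ, E) x}
    {A : M → List J → ℝ} {A' A'' : List J → ℝ} (h : HasDerivAlong v A A')
    (h' : HasDerivAlong v A A'') : A' = A'' :=
  funext fun l ↦ (h l).2.symm.trans (h' l).2

variable [IsManifold 𝓘(ℝ, E) ∞ M]

theorem smoothAt_extend {x : M} (w : TangentSpace 𝓘(ℝ, E) x) :
    ContMDiffAt 𝓘(ℝ, E) (𝓘(ℝ, E).prod 𝓘(ℝ, E)) ∞ (T% (FiberBundle.extend E w)) x :=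
  FiberBundle.contMDiffAt_extend 𝓘(ℝ, E) E w

theorem mdifferentiableAt_field {x : M} {Y : VField E M}
    (h : ContMDiffAt 𝓘(ℝ, E) (𝓘(ℝ, E).prod 𝓘(ℝ, E)) ∞ (T% Y) x) :
    MDifferentiableAt 𝓘(ℝ, E) (𝓘(ℝ, E).prod 𝓘(ℝ, E)) (T% Y) x :=
  h.mdifferentiableAt (by simp)

/-- The tangent bundle is trivialized at `x` by the derivative of the chart at `x`, and this
derivative is the identity at `x` itself. Hence `FiberBundle.extend` produces the field that is
constant in that chart. -/
theorem extend_eq_mfderiv_symm {x y : M} (hy : y ∈ (chartAt E x).source)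
    (w : TangentSpace 𝓘(ℝ, E) x) :
    FiberBundle.extend E w y
      = mfderiv 𝓘(ℝ, E) 𝓘(ℝ, E) (extChartAt 𝓘(ℝ, E) x).symm (extChartAt 𝓘(ℝ, E) x y) w := by
  have h1 := TangentBundle.symmL_trivializationAt (I := 𝓘(ℝ, E)) hy
  rw [ModelWithCorners.range_eq_univ, mfderivWithin_univ] at h1
  have h2 : ((trivializationAt E (TangentSpace 𝓘(ℝ, E)) x) ⟨x, w⟩).2 = w := by
    have h3 := TangentBundle.continuousLinearMapAt_trivializationAt (I := 𝓘(ℝ, E))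
      (mem_chart_source E x)
    rw [mfderiv_extChartAt_self] at h3
    have h4 := congrArg (fun L ↦ L w) h3
    rw [Bundle.Trivialization.continuousLinearMapAt_apply] at h4
    have hx := FiberBundle.mem_baseSet_trivializationAt' (F := E) (E := (TangentSpace 𝓘(ℝ, E) : M → Type _)) x
    rw [Bundle.Trivialization.coe_linearMapAt_of_mem _ hx] at h4
    exact h4
  rw [FiberBundle.extend, h2]
  have h5 := congrArg (fun L ↦ L w) h1
  have hy' : y ∈ (trivializationAt E (TangentSpace 𝓘(ℝ, E) : M → Type _) x).baseSet := hy
  exact (Bundle.Trivialization.symmL_apply (R := ℝ) _ hy' w).symm.trans h5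

theorem lieBracketWithin_const (u w z : E) :
    VectorField.lieBracketWithin ℝ (fun _ : E ↦ u) (fun _ ↦ w) Set.univ z = 0 := by
  simp [VectorField.lieBracketWithin]

theorem mlieBracket_extend {x : M} (u w : TangentSpace 𝓘(ℝ, E) x) :
    VectorField.mlieBracket 𝓘(ℝ, E) (FiberBundle.extend E u) (FiberBundle.extend E w) x = 0 := by
  have key (w : TangentSpace 𝓘(ℝ, E) x) :
      VectorField.mpullback 𝓘(ℝ, E) 𝓘(ℝ, E) (extChartAt 𝓘(ℝ, E) x).symm (FiberBundle.extend E w)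
        =ᶠ[𝓝 (extChartAt 𝓘(ℝ, E) x x)] fun _ ↦ w := by
    filter_upwards [(isOpen_extChartAt_target x).mem_nhds (mem_extChartAt_target x)] with y hy
    have h1 : (extChartAt 𝓘(ℝ, E) x).symm y ∈ (chartAt E x).source := by
      rw [← extChartAt_source 𝓘(ℝ, E)]; exact (extChartAt 𝓘(ℝ, E) x).map_target hy
    rw [VectorField.mpullback_apply, extend_eq_mfderiv_symm h1,
      (extChartAt 𝓘(ℝ, E) x).right_inv hy]
    have inv := isInvertible_mfderivWithin_extChartAt_symm (I := 𝓘(ℝ, E)) hy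
    rw [ModelWithCorners.range_eq_univ, mfderivWithin_univ] at inv
    exact inv.inverse_apply_eq.2 rfl
  rw [← VectorField.mlieBracketWithin_univ, VectorField.mlieBracketWithin_apply]
  simp only [ModelWithCorners.range_eq_univ, VectorField.mpullbackWithin_univ, Set.preimage_univ,
    Set.inter_univ]
  rw [(key u).lieBracketWithin_vectorField_eq_nhds (key w)]
  exact (congrArg _ (lieBracketWithin_const (E := E) u w _)).trans (map_zero _)

end Analysis

/-! ### Differentiating functions with values in alternating maps -/

section FiniteDim

variable {E : Type*} [NormedAddCommGroup E] [NormedSpace ℝ E]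

theorem extDeriv_apply_real {p : ℕ} {β : E → E [⋀^Fin p]→L[ℝ] ℝ} {z : E}
    (h : DifferentiableAt ℝ β z) (v : Fin (p + 1) → E) :
    extDeriv β z v = ∑ i : Fin (p + 1), (-1 : ℝ) ^ (i : ℕ) *
      fderiv ℝ (fun y ↦ β y (i.removeNth v)) z (v i) := by
  rw [extDeriv_apply h]
  simp

variable [FiniteDimensional ℝ E]

/-- Evaluation of alternating maps at tuples of basis vectors. -/
def evalBasis (E : Type*) [NormedAddCommGroup E] [NormedSpace ℝ E] [FiniteDimensional ℝ E] (p : ℕ) :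
    (E [⋀^Fin p]→L[ℝ] ℝ) →ₗ[ℝ] ((Fin p → Fin (Module.finrank ℝ E)) → ℝ) where
  toFun f r := f fun i ↦ Module.finBasis ℝ E (r i)
  map_add' _ _ := rfl
  map_smul' _ _ := rfl

theorem evalBasis_injective (p : ℕ) : Function.Injective (evalBasis E p) := by
  intro f f' h
  apply ContinuousAlternatingMap.toAlternatingMap_injective
  apply AlternatingMap.coe_multilinearMap_injective
  exact Module.Basis.ext_multilinear (fun _ ↦ Module.finBasis ℝ E) fun s ↦ congrFun h s

/-- An alternating map is recovered linearly, hence continuously, from its finitely many values on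
tuples of basis vectors. -/
theorem differentiableAt_alternating {F : Type*} [NormedAddCommGroup F] [NormedSpace ℝ F]
    {p : ℕ} {f : F → E [⋀^Fin p]→L[ℝ] ℝ} {z : F}
    (h : ∀ v : Fin p → E, DifferentiableAt ℝ (fun y ↦ f y v) z) : DifferentiableAt ℝ f z := by
  obtain ⟨G, hG⟩ := (evalBasis E p).exists_leftInverse_of_injective
    (LinearMap.ker_eq_bot.2 (evalBasis_injective p))
  have : f = fun y ↦ (LinearMap.toContinuousLinearMap G) (evalBasis E p (f y)) := by
    funext y
    exact (LinearMap.congr_fun hG (f y)).symm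
  rw [this]
  refine (LinearMap.toContinuousLinearMap G).differentiableAt.comp z ?_
  exact differentiableAt_pi.2 fun r ↦ h _

end FiniteDim

/-! ### The exterior derivative as the alternation of ∇ -/

section ExtD

variable {E : Type*} [NormedAddCommGroup E] [NormedSpace ℝ E]
  {M : Type*} [TopologicalSpace M] [ChartedSpace E M]

theorem mvfderiv_eq_fderiv {x : M} {f : M → ℝ}
    (hf : MDifferentiableAt 𝓘(ℝ, E) 𝓘(ℝ, ℝ) f x) (v : TangentSpace 𝓘(ℝ, E) x) :
    mvfderiv 𝓘(ℝ, E) f x v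
      = fderiv ℝ (f ∘ (extChartAt 𝓘(ℝ, E) x).symm) (extChartAt 𝓘(ℝ, E) x x) v := by
  rw [hf.mvfderiv, ModelWithCorners.range_eq_univ, fderivWithin_univ]
  rfl

theorem differentiableAt_comp_chart_symm {x : M} {f : M → ℝ}
    (hf : MDifferentiableAt 𝓘(ℝ, E) 𝓘(ℝ, ℝ) f x) :
    DifferentiableAt ℝ (f ∘ (extChartAt 𝓘(ℝ, E) x).symm) (extChartAt 𝓘(ℝ, E) x x) := by
  have := hf.differentiableWithinAt_writtenInExtChartAt
  rw [ModelWithCorners.range_eq_univ, differentiableWithinAt_univ] at this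
  exact this

variable [IsManifold 𝓘(ℝ, E) ∞ M]

theorem IsSmoothForm.mdifferentiableAt_extend {p : ℕ} {θ : Form E M p} (hθ : IsSmoothForm θ)
    {x : M} (w : Fin p → TangentSpace 𝓘(ℝ, E) x) :
    MDifferentiableAt 𝓘(ℝ, E) 𝓘(ℝ, ℝ) (fun y ↦ θ y fun i ↦ FiberBundle.extend E (w i) y) x :=
  (hθ x (fun i ↦ FiberBundle.extend E (w i)) fun i ↦ smoothAt_extend (w i)).mdifferentiableAt
    (by simp)

theorem chartRep_eventuallyEq {p : ℕ} (θ : Form E M p) (x : M)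
    (w : Fin p → TangentSpace 𝓘(ℝ, E) x) :
    (fun y ↦ chartRep θ x y w) =ᶠ[𝓝 (extChartAt 𝓘(ℝ, E) x x)]
      (fun z ↦ θ z fun i ↦ FiberBundle.extend E (w i) z) ∘ (extChartAt 𝓘(ℝ, E) x).symm := by
  filter_upwards [(isOpen_extChartAt_target x).mem_nhds (mem_extChartAt_target x)] with y hy
  have h1 : (extChartAt 𝓘(ℝ, E) x).symm y ∈ (chartAt E x).source := by
    rw [← extChartAt_source 𝓘(ℝ, E)]; exact (extChartAt 𝓘(ℝ, E) x).map_target hy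
  rw [Function.comp_apply]
  have h2 (i : Fin p) : FiberBundle.extend E (w i) ((extChartAt 𝓘(ℝ, E) x).symm y)
      = mfderiv 𝓘(ℝ, E) 𝓘(ℝ, E) (extChartAt 𝓘(ℝ, E) x).symm y (w i) := by
    rw [extend_eq_mfderiv_symm h1, (extChartAt 𝓘(ℝ, E) x).right_inv hy]
  simp only [h2]
  rfl

variable [FiniteDimensional ℝ E]

/-- Constant vectors in the chart correspond to the extended fields, whose brackets vanish, so only
directional derivatives appear. -/
theorem extD_eq_sum_mvfderiv {p : ℕ} {θ : Form E M p} (hθ : IsSmoothForm θ) (x : M)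
    (w : Fin (p + 1) → TangentSpace 𝓘(ℝ, E) x) :
    extD θ x w = ∑ i : Fin (p + 1), (-1 : ℝ) ^ (i : ℕ) *
      mvfderiv 𝓘(ℝ, E) (fun y ↦ θ y fun j ↦ FiberBundle.extend E (i.removeNth w j) y) x (w i) := by
  have hd : DifferentiableAt ℝ (chartRep θ x) (extChartAt 𝓘(ℝ, E) x x) :=
    differentiableAt_alternating fun v ↦
      (differentiableAt_comp_chart_symm (hθ.mdifferentiableAt_extend v)).congr_of_eventuallyEq
        (chartRep_eventuallyEq θ x v)
  have h1 : extD θ x w = extDeriv (chartRep θ x) (extChartAt 𝓘(ℝ, E) x x) w := by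
    rw [extD, mfderiv_extChartAt_self]
    rfl
  refine h1.trans ((extDeriv_apply_real hd w).trans ?_)
  refine Finset.sum_congr rfl fun i _ ↦ ?_
  rw [mvfderiv_eq_fderiv (hθ.mdifferentiableAt_extend _)]
  refine congrArg (fun r : ℝ ↦ (-1 : ℝ) ^ (i : ℕ) * r) ?_
  exact congrArg (fun L : E →L[ℝ] ℝ ↦ L (w i)) (chartRep_eventuallyEq θ x (i.removeNth w)).fderiv_eq

theorem map_cons_removeNth {V : Type*} [AddCommGroup V] [Module ℝ V] {p : ℕ}
    (θ : V [⋀^Fin (p + 1)]→ₗ[ℝ] ℝ) (k : Fin (p + 1)) (u : V) (t : Fin (p + 1) → V) :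
    (-1 : ℝ) ^ (k : ℕ) * θ (Fin.cons u (k.removeNth t) : Fin (p + 1) → V)
      = θ (Function.update t k u) := by
  have := θ.map_insertNth k u (k.removeNth t)
  rw [Fin.insertNth_removeNth] at this
  rw [this]
  simp [Matrix.vecCons]

/-- Alternation kills the terms coming from a symmetric family of endomorphisms. -/
theorem sum_der_symmetric_eq_zero {V : Type*} [AddCommGroup V] [Module ℝ V] {p : ℕ}
    (θ : V [⋀^Fin p]→ₗ[ℝ] ℝ) (T : V → V → V) (hT : ∀ u v, T u v = T v u) (w : Fin (p + 1) → V) :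
    ∑ i : Fin (p + 1), (-1 : ℝ) ^ (i : ℕ) *
      der (T (w i)) (onLists θ) (List.ofFn (i.removeNth w)) = 0 := by
  induction p with
  | zero => simp [der]
  | succ p ih =>
    obtain ⟨v, t, rfl⟩ : ∃ v t, w = (Fin.cons v t : Fin (p + 2) → V) :=
      ⟨w 0, Fin.tail w, (Fin.cons_self_tail w).symm⟩
    have hins : ins (onLists θ) v = onLists (θ.curryLeft v) := ins_onLists θ v
    -- Removing slot k + 1 leaves `v` in front. By symmetry its replacement is T v (t k), and these
    -- terms cancel the summand i = 0. The rest is the induction hypothesis for the contraction of θ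
    -- with `v`.
    have h1 (k : Fin (p + 1)) :
        (-1 : ℝ) ^ (k.succ : ℕ) * der (T (t k)) (onLists θ)
            (List.ofFn (k.succ.removeNth (Fin.cons v t : Fin (p + 2) → V) : Fin (p + 1) → V))
          = -(θ (Function.update t k (T v (t k)))
            + (-1 : ℝ) ^ (k : ℕ) * der (T (t k)) (onLists (θ.curryLeft v))
              (List.ofFn (k.removeNth t))) := by
      have h2 : (k.succ.removeNth (Fin.cons v t : Fin (p + 2) → V) : Fin (p + 1) → V)
          = Fin.cons v (k.removeNth t) := by
        funext i
        refine Fin.cases ?_ (fun i ↦ ?_) i <;> simp [Fin.removeNth]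
      rw [h2, List.ofFn_cons, der, ← List.ofFn_cons, onLists_ofFn, hins, Fin.val_succ, pow_succ,
        hT v, ← map_cons_removeNth]
      ring
    rw [Fin.sum_univ_succ]
    simp only [Fin.cons_succ, h1, Finset.sum_neg_distrib, Finset.sum_add_distrib]
    rw [ih, Fin.removeNth_zero, Fin.tail_cons, der_onLists_ofFn]
    simp

/-- Extended fields commute at `x`, so absence of torsion makes their covariant derivatives
symmetric in the two vectors. Alternation removes these Christoffel terms. -/
theorem extD_eq_sum_covDerivForm {g : SemiRiemannianMetric E M} {nabla : Connection E M}
    (hnabla : IsLeviCivita g nabla) {p : ℕ} {θ : Form E M p} (hθ : IsSmoothForm θ) (x : M)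
    (w : Fin (p + 1) → TangentSpace 𝓘(ℝ, E) x) :
    extD θ x w = ∑ i : Fin (p + 1), (-1 : ℝ) ^ (i : ℕ) *
      covDerivForm nabla θ x (w i) (i.removeNth w) := by
  have hsymm (u v : TangentSpace 𝓘(ℝ, E) x) : nabla (FiberBundle.extend E v) x u
      = nabla (FiberBundle.extend E u) x v := by
    have := hnabla.torsion_free x (FiberBundle.extend E u) (FiberBundle.extend E v)
      (mdifferentiableAt_field (smoothAt_extend u)) (mdifferentiableAt_field (smoothAt_extend v))
    rw [mlieBracket_extend, FiberBundle.extend_apply_self, FiberBundle.extend_apply_self] at this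
    exact sub_eq_zero.1 this
  have h0 := sum_der_symmetric_eq_zero (θ x).toAlternatingMap
    (fun u v ↦ nabla (FiberBundle.extend E v) x u) hsymm w
  rw [extD_eq_sum_mvfderiv hθ, eq_comm, ← sub_eq_zero, ← Finset.sum_sub_distrib, ← neg_eq_zero,
    ← Finset.sum_neg_distrib, ← h0]
  refine Finset.sum_congr rfl fun i _ ↦ ?_
  rw [der_onLists_ofFn, covDerivForm]
  simp only [ContinuousAlternatingMap.coe_toAlternatingMap]
  ring

end ExtD

/-! ### Leibniz rule for ∇ on forms, and a criterion for Killing–Yano tensors -/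

section FormCalculus

local infixl:70 " ⋏ " => shuffle

variable {E : Type*} [NormedAddCommGroup E] [NormedSpace ℝ E]
  {M : Type*} [TopologicalSpace M] [ChartedSpace E M]

/-- A form, evaluated on lists of vector fields. -/
def onFields {J : Type*} (Y : J → VField E M) {p : ℕ} (θ : Form E M p) : M → List J → ℝ :=
  fun y ↦ onLists fun w : Fin p → J ↦ θ y fun i ↦ Y (w i) y

theorem onLists_wedge [FiniteDimensional ℝ E] {p q r : ℕ} (h : p + q = r) (α : Form E M p) (β : Form E M q) (x : M) :
    onLists (wedge h α β x) = onLists (α x) ⋏ onLists (β x) :=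
  onLists_algWedge h (α x).toAlternatingMap (β x).toAlternatingMap

theorem onFields_wedge [FiniteDimensional ℝ E] {J : Type*} (Y : J → VField E M) {p q r : ℕ} (h : p + q = r)
    (α : Form E M p) (β : Form E M q) :
    onFields Y (wedge h α β) = fun y ↦ onFields Y α y ⋏ onFields Y β y := by
  funext y
  have key {p : ℕ} (θ : Form E M p) :
      onFields Y θ y = fun l ↦ onLists (θ y) (l.map fun j ↦ Y j y) :=
    onLists_comp (fun j ↦ Y j y) (θ y)
  rw [key, key, key, onLists_wedge, shuffle_comp_map]

variable [IsManifold 𝓘(ℝ, E) ∞ M]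

theorem IsSmoothForm.contMDiffAt_onFields {J : Type*} {Y : J → VField E M} {p : ℕ} {θ : Form E M p}
    (hθ : IsSmoothForm θ) {x : M}
    (hY : ∀ j, ContMDiffAt 𝓘(ℝ, E) (𝓘(ℝ, E).prod 𝓘(ℝ, E)) ∞ (T% (Y j)) x) (l : List J) :
    ContMDiffAt 𝓘(ℝ, E) 𝓘(ℝ, ℝ) ∞ (fun y ↦ onFields Y θ y l) x := by
  by_cases hl : l.length = p
  · simp only [onFields, onLists, hl, dite_true]
    exact hθ x _ fun i ↦ hY _
  · simp only [onFields, onLists, hl, dite_false]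
    exact contMDiffAt_const

theorem IsSmoothForm.add {p : ℕ} {α β : Form E M p} (hα : IsSmoothForm α) (hβ : IsSmoothForm β) :
    IsSmoothForm (α + β) := fun x Y hY ↦ (hα x Y hY).add (hβ x Y hY)

theorem IsSmoothForm.const_smul {p : ℕ} {α : Form E M p} (hα : IsSmoothForm α) (c : ℝ) :
    IsSmoothForm (c • α) := fun x Y hY ↦ contMDiffAt_const.mul (hα x Y hY)

theorem covDerivForm_add (nabla : Connection E M) {p : ℕ} {α β : Form E M p}
    (hα : IsSmoothForm α) (hβ : IsSmoothForm β) (x : M) (v : TangentSpace 𝓘(ℝ, E) x)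
    (w : Fin p → TangentSpace 𝓘(ℝ, E) x) :
    covDerivForm nabla (α + β) x v w = covDerivForm nabla α x v w + covDerivForm nabla β x v w := by
  have := mvfderiv_fun_add (hα.mdifferentiableAt_extend w) (hβ.mdifferentiableAt_extend w)
  simp only [covDerivForm, Pi.add_apply, ContinuousAlternatingMap.add_apply,
    Finset.sum_add_distrib]
  rw [this, add_apply]
  ring

theorem covDerivForm_smul (nabla : Connection E M) {p : ℕ} {α : Form E M p}
    (hα : IsSmoothForm α) (c : ℝ) (x : M) (v : TangentSpace 𝓘(ℝ, E) x)
    (w : Fin p → TangentSpace 𝓘(ℝ, E) x) :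
    covDerivForm nabla (c • α) x v w = c * covDerivForm nabla α x v w := by
  have := mvfderiv_fun_mul (mdifferentiableAt_const (c := c)) (hα.mdifferentiableAt_extend w)
  simp only [covDerivForm, Pi.smul_apply, ContinuousAlternatingMap.smul_apply, smul_eq_mul,
    mul_sub, Finset.mul_sum]
  rw [this]
  simp [mvfderiv_const]

/-- The covariant derivative of a form, as a function on lists. -/
def covList (nabla : Connection E M) {p : ℕ} (θ : Form E M p) (x : M)
    (v : TangentSpace 𝓘(ℝ, E) x) : List (TangentSpace 𝓘(ℝ, E) x) → ℝ :=
  onLists (covDerivForm nabla θ x v)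

theorem hasDerivAlong_onFields (nabla : Connection E M) {p : ℕ} {θ : Form E M p}
    (hθ : IsSmoothForm θ) (x : M) (v : TangentSpace 𝓘(ℝ, E) x) :
    HasDerivAlong v (onFields (fun w : TangentSpace 𝓘(ℝ, E) x ↦ FiberBundle.extend E w) θ)
      (covList nabla θ x v
        + der (fun w ↦ nabla (FiberBundle.extend E w) x v) (onLists (θ x))) := by
  intro l
  refine ⟨(hθ.contMDiffAt_onFields (fun w ↦ smoothAt_extend w) l).mdifferentiableAt (by simp), ?_⟩
  by_cases hl : l.length = p
  · obtain ⟨w, rfl⟩ : ∃ w : Fin p → TangentSpace 𝓘(ℝ, E) x, l = List.ofFn w :=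
      ⟨fun i ↦ l.get (i.cast hl.symm), by subst hl; simp⟩
    rw [Pi.add_apply, covList, der_onLists_ofFn]
    simp only [onFields, onLists_ofFn]
    rw [covDerivForm]
    ring
  · have h1 : onLists (covDerivForm nabla θ x v) l = 0 := onLists_hasDegree _ l hl
    have h2 := der_hasDegree (fun w ↦ nabla (FiberBundle.extend E w) x v)
      (onLists_hasDegree (θ x)) l hl
    rw [Pi.add_apply, covList, h1, h2]
    simp [onFields, onLists, hl, mvfderiv_const]

variable [FiniteDimensional ℝ E]

theorem IsSmoothForm.wedge {p q r : ℕ} (h : p + q = r) {α : Form E M p} {β : Form E M q}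
    (hα : IsSmoothForm α) (hβ : IsSmoothForm β) : IsSmoothForm (wedge h α β) := by
  intro x Y hY
  have h1 (y : M) : MixedSasaki.wedge h α β y (fun i ↦ Y i y)
      = (onFields Y α y ⋏ onFields Y β y) (List.ofFn fun i ↦ i) := by
    have := congrFun (congrFun (onFields_wedge Y h α β) y) (List.ofFn fun i ↦ i)
    rw [onFields, onLists_ofFn] at this
    exact this
  simp only [h1]
  exact contMDiffAt_shuffle (fun l ↦ hα.contMDiffAt_onFields hY l)
    (fun l ↦ hβ.contMDiffAt_onFields hY l) _

theorem isSmoothForm_wedgePow {θ : Form E M 2} (hθ : IsSmoothForm θ) (k : ℕ) :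
    IsSmoothForm (wedgePow θ k) := by
  induction k with
  | zero => exact fun _ _ _ ↦ contMDiffAt_const
  | succ k ih => exact ih.wedge _ hθ

/-- The derivative of the wedge on extended fields is computed in two ways. The `der` corrections
agree by `der_shuffle` and cancel. -/
theorem covList_wedge (nabla : Connection E M) {p q r : ℕ} (h : p + q = r) {α : Form E M p}
    {β : Form E M q} (hα : IsSmoothForm α) (hβ : IsSmoothForm β) (x : M)
    (v : TangentSpace 𝓘(ℝ, E) x) :
    covList nabla (wedge h α β) x v
      = covList nabla α x v ⋏ onLists (β x) + onLists (α x) ⋏ covList nabla β x v := by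
  have h1 := hasDerivAlong_onFields nabla (hα.wedge h hβ) x v
  rw [onFields_wedge] at h1
  have h2 := (hasDerivAlong_onFields nabla hα x v).shuffle (hasDerivAlong_onFields nabla hβ x v)
  have h3 := h1.unique h2
  have key {p : ℕ} (θ : Form E M p) :
      onFields (fun w : TangentSpace 𝓘(ℝ, E) x ↦ FiberBundle.extend E w) θ x = onLists (θ x) := by
    simp [onFields]
  rw [key, key, onLists_wedge, der_shuffle, shuffle_add_left, shuffle_add_right] at h3
  funext l
  have := congrFun h3 l
  simp only [Pi.add_apply] at this ⊢
  linarith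

theorem SemiRiemannianMetric.sum_val_dualBasis_smul (g : SemiRiemannianMetric E M) (x : M)
    (u : TangentSpace 𝓘(ℝ, E) x) :
    ∑ i, g.val x u ((g.bilin x).dualBasis (g.bilin_nondegenerate x)
      (Module.finBasis ℝ (TangentSpace 𝓘(ℝ, E) x)) i) •
        Module.finBasis ℝ (TangentSpace 𝓘(ℝ, E) x) i = u := by
  set b := Module.finBasis ℝ (TangentSpace 𝓘(ℝ, E) x)
  have hsymm : (g.bilin x).IsSymm := ⟨fun v w ↦ g.symm x v w⟩
  conv_rhs => rw [← b.sum_repr u]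
  refine Finset.sum_congr rfl fun i _ ↦ ?_
  conv_rhs => rw [← LinearMap.BilinForm.dualBasis_dualBasis (g.bilin_nondegenerate x) hsymm b]
  rw [LinearMap.BilinForm.dualBasis_repr_apply,
    LinearMap.BilinForm.dualBasis_dualBasis (g.bilin_nondegenerate x) hsymm b]
  rfl

/-- The metric trace of a skew-symmetric bilinear form vanishes. -/
theorem SemiRiemannianMetric.sum_alternating_dualBasis_eq_zero (g : SemiRiemannianMetric E M)
    (x : M) (A : TangentSpace 𝓘(ℝ, E) x → (TangentSpace 𝓘(ℝ, E) x →ₗ[ℝ] ℝ))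
    (hA : ∀ u v, A u v = -A v u) :
    ∑ i, A (Module.finBasis ℝ (TangentSpace 𝓘(ℝ, E) x) i)
      ((g.bilin x).dualBasis (g.bilin_nondegenerate x)
        (Module.finBasis ℝ (TangentSpace 𝓘(ℝ, E) x)) i) = 0 := by
  set b := Module.finBasis ℝ (TangentSpace 𝓘(ℝ, E) x) with hb
  set d := (g.bilin x).dualBasis (g.bilin_nondegenerate x) b with hd
  have h1 (i) : A (b i) (d i) = ∑ j, g.val x (d i) (d j) * A (b i) (b j) := by
    conv_lhs => rw [← g.sum_val_dualBasis_smul x (d i)]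
    simp [hd, hb]
  -- A double sum of the symmetric g(d i, d j) against the skew A(b i)(b j) changes sign when i and
  -- j are exchanged.
  have h2 : ∑ i, A (b i) (d i) = -∑ i, A (b i) (d i) := by
    conv_lhs => rw [Finset.sum_congr rfl fun i _ ↦ h1 i, Finset.sum_comm]
    rw [Finset.sum_congr rfl fun i _ ↦ h1 i, ← Finset.sum_neg_distrib]
    refine Finset.sum_congr rfl fun i _ ↦ ?_
    rw [← Finset.sum_neg_distrib]
    refine Finset.sum_congr rfl fun j _ ↦ ?_
    rw [g.symm, hA]
    ring
  linarith

/-- A form whose covariant derivative is totally skew-symmetric is Killing-Yano. -/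
theorem isKillingYano_of_alternating {g : SemiRiemannianMetric E M} {nabla : Connection E M}
    (hnabla : IsLeviCivita g nabla) {p : ℕ} {θ : Form E M (p + 1)} (hθ : IsSmoothForm θ)
    (hK : ∀ x, ∃ K : TangentSpace 𝓘(ℝ, E) x [⋀^Fin (p + 2)]→ₗ[ℝ] ℝ, ∀ v w,
      covDerivForm nabla θ x v w = K (Fin.cons v w)) :
    IsKillingYano g nabla θ := by
  have hco (x : M) (w : Fin p → TangentSpace 𝓘(ℝ, E) x) : codiff g nabla θ x w = 0 := by
    obtain ⟨K, hK⟩ := hK x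
    rw [codiff, neg_eq_zero]
    simp only [hK]
    let A (u : TangentSpace 𝓘(ℝ, E) x) : TangentSpace 𝓘(ℝ, E) x →ₗ[ℝ] ℝ :=
      { toFun v := (K.curryLeft u).curryLeft v w
        map_add' v v' := by simp
        map_smul' c v := by simp }
    have hself (u) : A u u = 0 := by
      change (K.curryLeft u).curryLeft u w = 0
      simp
    have hadd (u u' v) : A (u + u') v = A u v + A u' v := by
      change (K.curryLeft (u + u')).curryLeft v w = _
      simp [A]
    refine g.sum_alternating_dualBasis_eq_zero x A fun u v ↦ ?_
    have h := hself (u + v)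
    rw [hadd, map_add, map_add, hself, hself] at h
    linarith
  refine ⟨⟨hθ, fun x v w ↦ ?_⟩, hco⟩
  obtain ⟨K, hK⟩ := hK x
  have h0 : codiff g nabla θ x = 0 := funext (hco x)
  rw [h0, extD_eq_sum_covDerivForm hnabla hθ]
  -- All p + 2 terms of the alternation equal K, so dθ = (p + 2)K, which the factor 1/(p + 2) in the
  -- equation undoes.
  have h1 (u : Fin (p + 2) → TangentSpace 𝓘(ℝ, E) x) (i : Fin (p + 2)) :
      (-1 : ℝ) ^ (i : ℕ) * covDerivForm nabla θ x (u i) (i.removeNth u) = K u := by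
    rw [hK, map_cons_removeNth, Function.update_eq_self]
  rw [Finset.sum_congr rfl fun i _ ↦ h1 _ i, hK]
  simp [dualWedge]
  field_simp
  ring

end FormCalculus

/-! ### Algebra of the structure tensors and their covariant derivatives -/

section Structure

variable {E : Type*} [NormedAddCommGroup E] [NormedSpace ℝ E]
  {M : Type*} [TopologicalSpace M] [ChartedSpace E M] [IsManifold 𝓘(ℝ, E) ∞ M]

theorem SemiRiemannianMetric.contMDiffAt (g : SemiRiemannianMetric E M) {x : M} {Y Z : VField E M}
    (hY : ContMDiffAt 𝓘(ℝ, E) (𝓘(ℝ, E).prod 𝓘(ℝ, E)) ∞ (T% Y) x)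
    (hZ : ContMDiffAt 𝓘(ℝ, E) (𝓘(ℝ, E).prod 𝓘(ℝ, E)) ∞ (T% Z) x) :
    ContMDiffAt 𝓘(ℝ, E) 𝓘(ℝ, ℝ) ∞ (fun y ↦ g.val y (Y y) (Z y)) x := by
  have : ContMDiffAt 𝓘(ℝ, E) (𝓘(ℝ, E).prod 𝓘(ℝ)) ∞
      (fun y ↦ Bundle.TotalSpace.mk' ℝ (E := Bundle.Trivial M ℝ) y (g.val y (Y y) (Z y))) x := by
    apply ContMDiffAt.clm_bundle_apply₂ (F₁ := E) (F₂ := E)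
    · exact g.smooth x
    · exact hY
    · exact hZ
  rw [Bundle.contMDiffAt_totalSpace] at this
  exact this.2

theorem eps_mul_self (α : Fin 3) : eps α * eps α = 1 := by
  fin_cases α <;> simp [eps]

theorem eps_ne_zero (α : Fin 3) : eps α ≠ 0 := fun h ↦ by
  simpa [h] using eps_mul_self α

namespace MixedThreeStructure

variable (S : MixedThreeStructure E M)

theorem smoothAt_phi (α : Fin 3) {x : M} {Y : VField E M}
    (hY : ContMDiffAt 𝓘(ℝ, E) (𝓘(ℝ, E).prod 𝓘(ℝ, E)) ∞ (T% Y) x) :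
    ContMDiffAt 𝓘(ℝ, E) (𝓘(ℝ, E).prod 𝓘(ℝ, E)) ∞ (T% fun y ↦ S.φ α y (Y y)) x :=
  ContMDiffAt.clm_bundle_apply (F₁ := E) (F₂ := E) (S.φ_smooth α x) hY

theorem xi_ne_zero (α : Fin 3) (x : M) : S.ξ α x ≠ 0 := fun h ↦ by
  have := S.η_ξ_self α x
  rw [h, map_zero] at this
  exact eps_ne_zero α this.symm

/-- Here φ²ξ = 0, and φ² applied to φξ shows that φξ is a multiple of ξ. The square of the factor
then kills ξ ≠ 0, so the factor is zero. -/
theorem phi_xi_self (α : Fin 3) (x : M) : S.φ α x (S.ξ α x) = 0 := by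
  have h1 : S.φ α x (S.φ α x (S.ξ α x)) = 0 := by
    rw [S.φ_sq, S.η_ξ_self]; simp
  have h2 := S.φ_sq α x (S.φ α x (S.ξ α x))
  rw [h1, map_zero, eq_comm, neg_add_eq_zero] at h2
  set c := S.η α x (S.φ α x (S.ξ α x))
  have h3 : S.φ α x (S.ξ α x) = (eps α * c) • S.ξ α x := by
    rw [mul_smul, ← h2, smul_smul, eps_mul_self, one_smul]
  have h4 : ((eps α * c) * (eps α * c)) • S.ξ α x = 0 := by
    rw [mul_smul, ← h3, ← map_smul, ← h3, h1]
  rcases smul_eq_zero.1 h4 with h | h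
  · rw [h3, mul_self_eq_zero.1 h, zero_smul]
  · exact absurd h (S.xi_ne_zero α x)

/-- Computing φ³v as φ²(φv) and as φ(φ²v) leaves η(φv)ξ = 0. -/
theorem eta_phi_self (α : Fin 3) (x : M) (v : TangentSpace 𝓘(ℝ, E) x) :
    S.η α x (S.φ α x v) = 0 := by
  have h1 := S.φ_sq α x (S.φ α x v)
  have h2 := congrArg (S.φ α x) (S.φ_sq α x v)
  rw [h1] at h2
  simp only [map_add, map_neg, map_smul, S.phi_xi_self, smul_zero] at h2
  exact (smul_eq_zero.1 (add_left_cancel h2)).resolve_right (S.xi_ne_zero α x)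

end MixedThreeStructure

namespace IsCompatibleMetric

variable {g : SemiRiemannianMetric E M} {S : MixedThreeStructure E M}

theorem val_xi_self (h : IsCompatibleMetric g S) (α : Fin 3) (x : M) :
    g.val x (S.ξ α x) (S.ξ α x) = eps α := by
  rw [h.ξ_dual, S.η_ξ_self]

theorem val_phi_left (h : IsCompatibleMetric g S) (α : Fin 3) (x : M)
    (v w : TangentSpace 𝓘(ℝ, E) x) : g.val x (S.φ α x v) w = -g.val x v (S.φ α x w) := by
  have h1 := h.φ_φ α x v (S.φ α x w)
  rw [S.φ_sq, S.eta_phi_self, mul_zero, sub_zero, map_add, map_neg, map_smul, map_smul, h.ξ_dual,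
    S.eta_phi_self, smul_zero, add_zero, smul_eq_mul, ← mul_neg] at h1
  have := congrArg (eps α * ·) h1
  simp only [mul_neg, ← mul_assoc, eps_mul_self, one_mul] at this
  linarith

end IsCompatibleMetric

namespace IsMixedThreeSasakian

variable {g : SemiRiemannianMetric E M} {nabla : Connection E M} {S : MixedThreeStructure E M}

/-- For ε = −1 the two terms η(v)η(Y)ξ cancel, so one formula serves all three structures. -/
theorem covDerivEnd_phi (hS : IsMixedThreeSasakian g nabla S) (α : Fin 3) (x : M)
    (v : TangentSpace 𝓘(ℝ, E) x) (Y : VField E M)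
    (hY : ContMDiffAt 𝓘(ℝ, E) (𝓘(ℝ, E).prod 𝓘(ℝ, E)) ∞ (T% Y) x) :
    covDerivEnd nabla (S.φ α) x v Y = g.val x v (Y x) • S.ξ α x - S.η α x (Y x) • v := by
  rcases eq_or_ne α 0 with rfl | hα
  · exact hS.sasakian x v Y hY
  · have he : eps α = -1 := by
      fin_cases α <;> simp_all [eps]
    rw [hS.lp_sasakian α hα x v Y hY, hS.φ_φ, S.φ_sq, he]
    module

/-- With Y = ξ the formula for ∇φ determines φ(∇_v ξ). The constant length of ξ gives η(∇_v ξ) = 0,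
so a further application of φ recovers ∇_v ξ. -/
theorem nabla_xi (hnabla : IsLeviCivita g nabla) (hS : IsMixedThreeSasakian g nabla S) (α : Fin 3)
    (x : M) (v : TangentSpace 𝓘(ℝ, E) x) : nabla (S.ξ α) x v = -S.φ α x v := by
  have h1 := hS.covDerivEnd_phi α x v (S.ξ α) (S.ξ_smooth α x)
  have h0 : (fun y ↦ S.φ α y (S.ξ α y)) = 0 := funext fun y ↦ S.phi_xi_self α y
  rw [covDerivEnd, h0, CovariantDerivative.zero, Pi.zero_apply, zero_apply, zero_sub, hS.ξ_dual,
    S.η_ξ_self] at h1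
  have hη : S.η α x (nabla (S.ξ α) x v) = 0 := by
    have hd := mdifferentiableAt_field (S.ξ_smooth α x)
    have h2 := hnabla.metric x v (S.ξ α) (S.ξ α) hd hd
    simp only [hS.val_xi_self] at h2
    rw [mvfderiv_const, zero_apply, g.symm x (S.ξ α x), hS.ξ_dual] at h2
    linarith
  have h3 := congrArg (S.φ α x) h1
  rw [map_neg, S.φ_sq, hη, map_sub, map_smul, map_smul, S.phi_xi_self] at h3
  have h4 : eps α • (nabla (S.ξ α) x v + S.φ α x v) = 0 := by
    rw [smul_add]
    simp only [zero_smul, add_zero, neg_neg, smul_zero, zero_sub] at h3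
    rw [h3, neg_add_cancel]
  exact eq_neg_of_add_eq_zero_left ((smul_eq_zero.1 h4).resolve_left (eps_ne_zero α))

/-- The vector fields of a mixed 3-Sasakian structure are Killing. -/
theorem isKillingField_xi (hnabla : IsLeviCivita g nabla) (hS : IsMixedThreeSasakian g nabla S)
    (α : Fin 3) : IsKillingField g (S.ξ α) := by
  refine ⟨S.ξ_smooth α, fun x Y Z hY hZ ↦ ?_⟩
  have hξ := mdifferentiableAt_field (S.ξ_smooth α x)
  have hY' := mdifferentiableAt_field hY
  have hZ' := mdifferentiableAt_field hZ
  rw [hnabla.metric x _ Y Z hY' hZ', ← hnabla.torsion_free x _ _ hξ hY',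
    ← hnabla.torsion_free x _ _ hξ hZ', hS.nabla_xi hnabla, hS.nabla_xi hnabla]
  -- Only −g(φY, Z) − g(Y, φZ) survives, and φ is g-skew.
  simp only [map_sub, map_neg, sub_apply, neg_apply]
  rw [hS.val_phi_left]
  ring

theorem covDerivForm_eta (hnabla : IsLeviCivita g nabla) (hS : IsMixedThreeSasakian g nabla S)
    (α : Fin 3) (x : M) (v : TangentSpace 𝓘(ℝ, E) x) (w : Fin 1 → TangentSpace 𝓘(ℝ, E) x) :
    covDerivForm nabla (oneForm (S.η α)) x v w = g.val x v (S.φ α x (w 0)) := by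
  have h1 := hnabla.metric x v (FiberBundle.extend E (w 0)) (S.ξ α)
    (mdifferentiableAt_field (smoothAt_extend (w 0))) (mdifferentiableAt_field (S.ξ_smooth α x))
  simp only [hS.ξ_dual, FiberBundle.extend_apply_self, hS.nabla_xi hnabla] at h1
  have h2 (y : M) (u : Fin 1 → TangentSpace 𝓘(ℝ, E) y) :
      oneForm (S.η α) y u = S.η α y (u 0) := rfl
  simp only [covDerivForm, h2]
  rw [h1, Fin.sum_univ_one, Function.update_self, map_neg, ← hS.val_phi_left, g.symm]
  ring

variable [FiniteDimensional ℝ E]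

theorem extD_eta (hnabla : IsLeviCivita g nabla) (hS : IsMixedThreeSasakian g nabla S)
    (α : Fin 3) (x : M) (w : Fin 2 → TangentSpace 𝓘(ℝ, E) x) :
    extD (oneForm (S.η α)) x w = 2 * g.val x (w 0) (S.φ α x (w 1)) := by
  rw [extD_eq_sum_covDerivForm hnabla (S.η_smooth α), Fin.sum_univ_two,
    hS.covDerivForm_eta hnabla, hS.covDerivForm_eta hnabla]
  have h0 : (0 : Fin 2).removeNth w 0 = w 1 := rfl
  have h1 : (1 : Fin 2).removeNth w 0 = w 0 := rfl
  rw [h0, h1, g.symm x (w 1), hS.val_phi_left]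
  simp
  ring

theorem isSmoothForm_extD_eta (hnabla : IsLeviCivita g nabla)
    (hS : IsMixedThreeSasakian g nabla S) (α : Fin 3) :
    IsSmoothForm (extD (oneForm (S.η α))) := by
  intro x Y hY
  simp only [hS.extD_eta hnabla]
  exact contMDiffAt_const.mul (g.contMDiffAt (hY 0) (S.smoothAt_phi α (hY 1)))

/-- As ∇g = 0, differentiating 2g(·, φ·) touches only φ. -/
theorem covDerivForm_extD_eta (hnabla : IsLeviCivita g nabla)
    (hS : IsMixedThreeSasakian g nabla S) (α : Fin 3) (x : M) (v : TangentSpace 𝓘(ℝ, E) x)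
    (w : Fin 2 → TangentSpace 𝓘(ℝ, E) x) :
    covDerivForm nabla (extD (oneForm (S.η α))) x v w
      = 2 * (S.η α x (w 0) * g.val x v (w 1) - S.η α x (w 1) * g.val x v (w 0)) := by
  have hs (i : Fin 2) := smoothAt_extend (E := E) (w i)
  have h1 := hnabla.metric x v (FiberBundle.extend E (w 0))
    (fun y ↦ S.φ α y (FiberBundle.extend E (w 1) y)) (mdifferentiableAt_field (hs 0))
    (mdifferentiableAt_field (S.smoothAt_phi α (hs 1)))
  have h2 := hS.covDerivEnd_phi α x v _ (hs 1)
  rw [covDerivEnd, sub_eq_iff_eq_add] at h2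
  have h3 := mvfderiv_fun_mul (mdifferentiableAt_const (c := (2 : ℝ)))
    ((g.contMDiffAt (hs 0) (S.smoothAt_phi α (hs 1))).mdifferentiableAt (by simp))
  simp only [covDerivForm, hS.extD_eta hnabla]
  rw [h3]
  simp only [mvfderiv_const, add_apply, smul_apply, h1, h2, FiberBundle.extend_apply_self, map_add,
    map_sub, map_smul, hS.ξ_dual, smul_eq_mul]
  rw [g.symm x v (w 0)]
  simp
  ring

end IsMixedThreeSasakian

end Structure

/-! ### Wedge powers of a 2-form -/

section Powers

local infixl:70 " ⋏ " => shuffle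

variable {E : Type*} [NormedAddCommGroup E] [NormedSpace ℝ E] [FiniteDimensional ℝ E]
  {M : Type*} [TopologicalSpace M] [ChartedSpace E M]

theorem onLists_wedgePow_zero (θ : Form E M 2) (x : M) :
    onLists (wedgePow θ 0 x) = unitFun := by
  refine (onLists_hasDegree (wedgePow θ 0 x)).ext (p := 0) ?_ fun w ↦ ?_
  · intro l hl
    cases l with
    | nil => simp at hl
    | cons _ _ => rfl
  · rw [List.ofFn_zero]
    rfl

theorem onLists_wedgePow_succ (θ : Form E M 2) (k : ℕ) (x : M) :
    onLists (wedgePow θ (k + 1) x) = onLists (wedgePow θ k x) ⋏ onLists (θ x) :=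
  onLists_wedge _ _ _ x

theorem bar_onLists_wedgePow (θ : Form E M 2) (k : ℕ) (x : M) :
    bar (onLists (wedgePow θ k x)) = onLists (wedgePow θ k x) := by
  rw [(onLists_hasDegree _).bar_eq, pow_mul]
  simp

/-- The power rule: contraction acts without signs on powers of an even form, and such powers
commute with everything. -/
theorem ins_onLists_wedgePow_succ (θ : Form E M 2) (k : ℕ) (x : M)
    (v : TangentSpace 𝓘(ℝ, E) x) :
    ins (onLists (wedgePow θ (k + 1) x)) v
      = ((k : ℝ) + 1) • (ins (onLists (θ x)) v ⋏ onLists (wedgePow θ k x)) := by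
  induction k with
  | zero =>
    rw [onLists_wedgePow_succ, onLists_wedgePow_zero, unitFun_shuffle, shuffle_unitFun]
    simp
  | succ k ih =>
    rw [onLists_wedgePow_succ, ins_shuffle, ih, shuffle_smul_left, shuffle_assoc,
      ← onLists_wedgePow_succ, bar_onLists_wedgePow,
      ← shuffle_comm_of_even _ (bar_onLists_wedgePow θ (k + 1) x)]
    push_cast
    module

end Powers

/-! ### The forms η ∧ (dη)^k and dη: Killing–Yano equations and nonvanishing -/

section Contact

local infixl:70 " ⋏ " => shuffle

variable {E : Type*} [NormedAddCommGroup E] [NormedSpace ℝ E] [FiniteDimensional ℝ E]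
  {M : Type*} [TopologicalSpace M] [ChartedSpace E M] [IsManifold 𝓘(ℝ, E) ∞ M]

theorem covList_wedgePow_zero (nabla : Connection E M) (θ : Form E M 2) (x : M)
    (v : TangentSpace 𝓘(ℝ, E) x) : covList nabla (wedgePow θ 0) x v = 0 := by
  have : covDerivForm nabla (wedgePow θ 0) x v = 0 := by
    funext w
    rw [covDerivForm]
    have h (y : M) (u : Fin (2 * 0) → TangentSpace 𝓘(ℝ, E) y) : wedgePow θ 0 y u = 1 := rfl
    simp only [h, mvfderiv_const]
    simp
  rw [covList, this]
  funext l
  simp [onLists]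

namespace IsMixedThreeSasakian

variable {g : SemiRiemannianMetric E M} {nabla : Connection E M} {S : MixedThreeStructure E M}

theorem covList_eta (hnabla : IsLeviCivita g nabla) (hS : IsMixedThreeSasakian g nabla S)
    (α : Fin 3) (x : M) (v : TangentSpace 𝓘(ℝ, E) x) :
    covList nabla (oneForm (S.η α)) x v
      = (1 / 2 : ℝ) • ins (onLists (extD (oneForm (S.η α)) x)) v := by
  rw [ins_onLists, ← onLists_smul, covList]
  congr 1
  funext w
  rw [hS.covDerivForm_eta hnabla, Pi.smul_apply, hS.extD_eta hnabla]
  simp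

theorem covList_extD_eta (hnabla : IsLeviCivita g nabla) (hS : IsMixedThreeSasakian g nabla S)
    (α : Fin 3) (x : M) (v : TangentSpace 𝓘(ℝ, E) x) :
    covList nabla (extD (oneForm (S.η α))) x v
      = (2 : ℝ) • (onLists (oneForm (S.η α) x) ⋏ onLists fun w : Fin 1 → _ ↦ g.val x v (w 0)) := by
  refine (onLists_hasDegree _).ext (((onLists_hasDegree _).shuffle (onLists_hasDegree _)).smul _)
    fun w ↦ ?_
  rw [onLists_ofFn, hS.covDerivForm_extD_eta hnabla, Pi.smul_apply, one_shuffle_ofFn,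
    Fin.sum_univ_two, onLists_ofFn, onLists_ofFn]
  have h0 : (0 : Fin 2).removeNth w 0 = w 1 := rfl
  have h1 : (1 : Fin 2).removeNth w 0 = w 0 := rfl
  have h2 (u : TangentSpace 𝓘(ℝ, E) x) : oneForm (S.η α) x (fun _ ↦ u) = S.η α x u := rfl
  rw [h0, h1, h2, h2]
  simp
  ring

/-- Every Leibniz term contains ∇_v ω = 2 η ∧ v*. Once η is moved past the even powers of ω, it
meets this η, and η ∧ η = 0. -/
theorem eta_shuffle_covList_wedgePow (hnabla : IsLeviCivita g nabla)
    (hS : IsMixedThreeSasakian g nabla S) (α : Fin 3) (k : ℕ) (x : M)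
    (v : TangentSpace 𝓘(ℝ, E) x) :
    onLists (oneForm (S.η α) x) ⋏ covList nabla (wedgePow (extD (oneForm (S.η α))) k) x v = 0 := by
  induction k with
  | zero => rw [covList_wedgePow_zero, shuffle_zero_right]
  | succ k ih =>
    have hω := hS.isSmoothForm_extD_eta hnabla α
    have hη : bar (onLists (oneForm (S.η α) x)) = -onLists (oneForm (S.η α) x) := by
      rw [(onLists_hasDegree _).bar_eq]; simp
    rw [wedgePow, covList_wedge nabla _ (isSmoothForm_wedgePow hω k) hω, shuffle_add_right,
      ← shuffle_assoc, ih, shuffle_zero_left, zero_add, ← shuffle_assoc,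
      shuffle_comm_of_even _ (bar_onLists_wedgePow _ k x), shuffle_assoc,
      hS.covList_extD_eta hnabla, shuffle_smul_right, ← shuffle_assoc, shuffle_self_of_odd hη,
      shuffle_zero_left, smul_zero, shuffle_zero_right]

theorem isSmoothForm_contactForm (hnabla : IsLeviCivita g nabla)
    (hS : IsMixedThreeSasakian g nabla S) (α : Fin 3) (k : ℕ) :
    IsSmoothForm (contactForm (oneForm (S.η α)) k) :=
  (S.η_smooth α).wedge _ (isSmoothForm_wedgePow (hS.isSmoothForm_extD_eta hnabla α) k)

/-- Only (∇_v η) ∧ ω^k = ½ (v⌟ω) ∧ ω^k remains, and the power rule turns it into a contraction of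
ω^(k+1). This exhibits the total skewness. -/
theorem covDerivForm_contactForm (hnabla : IsLeviCivita g nabla)
    (hS : IsMixedThreeSasakian g nabla S) (α : Fin 3) (k : ℕ) (x : M)
    (v : TangentSpace 𝓘(ℝ, E) x) (w : Fin (2 * k + 1) → TangentSpace 𝓘(ℝ, E) x) :
    covDerivForm nabla (contactForm (oneForm (S.η α)) k) x v w
      = (1 / (2 * ((k : ℝ) + 1))) * wedgePow (extD (oneForm (S.η α))) (k + 1) x
        (Fin.cons v w : Fin (2 * k + 2) → TangentSpace 𝓘(ℝ, E) x) := by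
  have h1 : covList nabla (contactForm (oneForm (S.η α)) k) x v
      = (1 / (2 * ((k : ℝ) + 1))) •
        ins (onLists (wedgePow (extD (oneForm (S.η α))) (k + 1) x)) v := by
    rw [contactForm, covList_wedge nabla _ (S.η_smooth α)
      (isSmoothForm_wedgePow (hS.isSmoothForm_extD_eta hnabla α) k),
      hS.eta_shuffle_covList_wedgePow hnabla, add_zero, hS.covList_eta hnabla, shuffle_smul_left,
      ins_onLists_wedgePow_succ, smul_smul]
    congr 1
    have : (k : ℝ) + 1 ≠ 0 := by positivity
    field_simp
  have h2 := congrFun h1 (List.ofFn w)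
  rw [covList, onLists_ofFn, Pi.smul_apply, ins, ← List.ofFn_cons] at h2
  rw [h2, smul_eq_mul]
  congr 1
  exact onLists_ofFn (p := 2 * k + 2) _ _

/-- Linear combinations of the forms `η ∧ (dη)^k` are Killing-Yano tensors. -/
theorem isKillingYano_sum_contactForm (hnabla : IsLeviCivita g nabla)
    (hS : IsMixedThreeSasakian g nabla S) (k : ℕ) (c : Fin 3 → ℝ) :
    IsKillingYano g nabla (∑ α, c α • contactForm (oneForm (S.η α)) k) := by
  have hs (α : Fin 3) := (hS.isSmoothForm_contactForm hnabla α k).const_smul (c α)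
  rw [Fin.sum_univ_three]
  refine isKillingYano_of_alternating hnabla (((hs 0).add (hs 1)).add (hs 2)) fun x ↦
    ⟨∑ α, (c α * (1 / (2 * ((k : ℝ) + 1)))) •
      (wedgePow (extD (oneForm (S.η α))) (k + 1) x).toAlternatingMap, fun v w ↦ ?_⟩
  rw [covDerivForm_add nabla ((hs 0).add (hs 1)) (hs 2), covDerivForm_add nabla (hs 0) (hs 1)]
  simp only [covDerivForm_smul nabla (hS.isSmoothForm_contactForm hnabla _ k),
    hS.covDerivForm_contactForm hnabla, Fin.sum_univ_three, ← mul_assoc]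
  rfl

theorem isKillingYano_contactForm (hnabla : IsLeviCivita g nabla)
    (hS : IsMixedThreeSasakian g nabla S) (α : Fin 3) (k : ℕ) :
    IsKillingYano g nabla (contactForm (oneForm (S.η α)) k) := by
  have := hS.isKillingYano_sum_contactForm hnabla k (Pi.single α 1)
  simpa [Pi.single_apply, ite_smul] using this

theorem isKillingYano_eta (hnabla : IsLeviCivita g nabla)
    (hS : IsMixedThreeSasakian g nabla S) (α : Fin 3) :
    IsKillingYano g nabla (oneForm (S.η α)) := by
  refine isKillingYano_of_alternating hnabla (S.η_smooth α) fun x ↦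
    ⟨(1 / 2 : ℝ) • (extD (oneForm (S.η α)) x).toAlternatingMap, fun v w ↦ ?_⟩
  rw [hS.covDerivForm_eta hnabla, AlternatingMap.smul_apply,
    ContinuousAlternatingMap.coe_toAlternatingMap, hS.extD_eta hnabla]
  simp

/-- In the trace of 2 η ∧ e_i*, one term reassembles η (`h2`) and the other sums g(e_i, e^i) = 1 to
the dimension (`h1`). -/
theorem codiff_extD_eta (hnabla : IsLeviCivita g nabla)
    (hS : IsMixedThreeSasakian g nabla S) (α : Fin 3) (x : M)
    (w : Fin 1 → TangentSpace 𝓘(ℝ, E) x) :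
    codiff g nabla (extD (oneForm (S.η α))) x w
      = 2 * ((Module.finrank ℝ E : ℝ) - 1) * S.η α x (w 0) := by
  simp only [codiff, hS.covDerivForm_extD_eta hnabla]
  set b := Module.finBasis ℝ (TangentSpace 𝓘(ℝ, E) x) with hb
  set d := (g.bilin x).dualBasis (g.bilin_nondegenerate x) b with hd
  have h1 (i) : g.val x (b i) (d i) = 1 := by
    rw [g.symm]
    have := LinearMap.BilinForm.apply_dualBasis_left (g.bilin_nondegenerate x) b i i
    simpa [SemiRiemannianMetric.bilin_apply] using this
  have h2 : ∑ i, S.η α x (d i) * g.val x (b i) (w 0) = S.η α x (w 0) := by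
    rw [← hS.ξ_dual α x (w 0), g.symm x (w 0)]
    conv_rhs => rw [← g.sum_val_dualBasis_smul x (S.ξ α x)]
    rw [map_sum, sum_apply]
    refine Finset.sum_congr rfl fun i _ ↦ ?_
    rw [map_smul, smul_apply, smul_eq_mul, ← hS.ξ_dual, g.symm]
  have h3 : (Module.finrank ℝ (TangentSpace 𝓘(ℝ, E) x) : ℝ) = Module.finrank ℝ E := rfl
  have h4 : ∑ i, 2 * (S.η α x (d i) * g.val x (b i) (w 0) - S.η α x (w 0) * g.val x (b i) (d i))
      = 2 * (S.η α x (w 0) - S.η α x (w 0) * Module.finrank ℝ E) := by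
    rw [← Finset.mul_sum, Finset.sum_sub_distrib, h2]
    simp [h1, h3, mul_comm]
  simp only [Fin.cons_zero, Fin.cons_one]
  rw [h4]
  ring

theorem extD_extD_eta (hnabla : IsLeviCivita g nabla) (hS : IsMixedThreeSasakian g nabla S)
    (α : Fin 3) (x : M) (w : Fin 3 → TangentSpace 𝓘(ℝ, E) x) :
    extD (extD (oneForm (S.η α))) x w = 0 := by
  rw [extD_eq_sum_covDerivForm hnabla (hS.isSmoothForm_extD_eta hnabla α), Fin.sum_univ_three]
  simp only [hS.covDerivForm_extD_eta hnabla]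
  have h0 : (0 : Fin 3).removeNth w = ![w 1, w 2] := by
    funext i; fin_cases i <;> rfl
  have h1 : (1 : Fin 3).removeNth w = ![w 0, w 2] := by
    funext i; fin_cases i <;> rfl
  have h2 : (2 : Fin 3).removeNth w = ![w 0, w 1] := by
    funext i; fin_cases i <;> rfl
  rw [h0, h1, h2]
  simp only [Matrix.cons_val_zero, Matrix.cons_val_one]
  rw [g.symm x (w 1) (w 0), g.symm x (w 2) (w 0), g.symm x (w 2) (w 1)]
  simp
  ring

/-- With dω = 0, the coefficient 1/(m − 1) cancels the m − 1 in d*ω and leaves ∇_X ω. Strictness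
comes from d*ω(ξ) = 2(m − 1)ε, which needs a point and m ≠ 1. -/
theorem isStrictlyConformalKillingYano_extD_eta [Nonempty M] (hE : Module.finrank ℝ E ≠ 1)
    (hnabla : IsLeviCivita g nabla) (hS : IsMixedThreeSasakian g nabla S) (α : Fin 3) :
    IsStrictlyConformalKillingYano g nabla (extD (oneForm (S.η α))) := by
  have hE' : (Module.finrank ℝ E : ℝ) - 1 ≠ 0 := sub_ne_zero.2 (by exact_mod_cast hE)
  refine ⟨⟨hS.isSmoothForm_extD_eta hnabla α, fun x X w ↦ ?_⟩, fun h ↦ ?_⟩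
  · rw [hS.extD_extD_eta hnabla, hS.covDerivForm_extD_eta hnabla, dualWedge, Fin.sum_univ_two,
      hS.codiff_extD_eta hnabla, hS.codiff_extD_eta hnabla]
    have h0 : (0 : Fin 2).removeNth w 0 = w 1 := rfl
    have h1 : (1 : Fin 2).removeNth w 0 = w 0 := rfl
    have h2 : (Module.finrank ℝ E : ℝ) - ((1 + 1 : ℕ) : ℝ) + 1 = Module.finrank ℝ E - 1 := by
      push_cast; ring
    rw [h0, h1, h2]
    field_simp
    simp
    ring
  · obtain ⟨x⟩ := ‹Nonempty M›
    have := h.2 x fun _ ↦ S.ξ α x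
    rw [hS.codiff_extD_eta hnabla, S.η_ξ_self] at this
    exact mul_ne_zero (mul_ne_zero two_ne_zero hE') (eps_ne_zero α) this

/-- Given ω^k(w) ≠ 0, add a pair (v, u) with ω(v, u) ≠ 0 and ω(v, w_i) = 0. Then (v⌟ω) ∧ ω^k at (u,
w) is the single product ω(v, u) ω^k(w). -/
theorem onLists_wedgePow_extD_eta_ne_zero (hnabla : IsLeviCivita g nabla)
    (hS : IsMixedThreeSasakian g nabla S) (α : Fin 3) (x : M) (k : ℕ)
    (hk : 2 * k < Module.finrank ℝ E + 1) :
    onLists (wedgePow (extD (oneForm (S.η α))) k x) ≠ 0 := by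
  induction k with
  | zero =>
    rw [onLists_wedgePow_zero]
    intro h
    simpa [unitFun] using congrFun h []
  | succ k ih =>
    intro h0
    obtain ⟨w, hw⟩ : ∃ w : Fin (2 * k) → TangentSpace 𝓘(ℝ, E) x,
        wedgePow (extD (oneForm (S.η α))) k x w ≠ 0 := by
      by_contra! hcon
      refine ih (by omega) ((onLists_hasDegree _).ext (p := 2 * k) (fun _ _ ↦ rfl) fun w ↦ ?_)
      rw [onLists_ofFn, hcon]; rfl
    -- The conditions on `v` are 2k + 1 linear equations: η(v) = 0 and ω(v, w_i) = 0. The degree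
    -- bound at k + 1 says exactly that 2k + 1 is less than the dimension.
    let L : TangentSpace 𝓘(ℝ, E) x →ₗ[ℝ] (Fin (2 * k + 1) → ℝ) := LinearMap.pi
      (Fin.cons (S.η α x).toLinearMap fun i ↦ (g.bilin x).flip (S.φ α x (w i)))
    obtain ⟨v, hv, hv0⟩ : ∃ v ∈ LinearMap.ker L, v ≠ 0 := by
      refine (Submodule.ne_bot_iff _).1 (LinearMap.ker_ne_bot_of_finrank_lt ?_)
      rw [Module.finrank_fin_fun]
      change 2 * k + 1 < Module.finrank ℝ E
      omega
    have hLv := LinearMap.mem_ker.1 hv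
    have hη : S.η α x v = 0 := congrFun hLv 0
    have hg (i) : g.val x v (S.φ α x (w i)) = 0 := congrFun hLv (Fin.succ i)
    -- Otherwise φv = 0, but φ² = −ε on ker η, which would force v = 0.
    obtain ⟨u, hu⟩ : ∃ u, g.val x v (S.φ α x u) ≠ 0 := by
      by_contra! hcon
      have h1 : S.φ α x v = 0 := g.nondeg x _ fun u ↦ by rw [hS.val_phi_left, hcon, neg_zero]
      have h2 := S.φ_sq α x v
      rw [h1, map_zero, hη, zero_smul, add_zero, eq_comm, neg_eq_zero] at h2
      exact hv0 ((smul_eq_zero.1 h2).resolve_left (eps_ne_zero α))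
    have h1 := ins_onLists_wedgePow_succ (extD (oneForm (S.η α))) k x v
    rw [h0, ins_zero, eq_comm, smul_eq_zero] at h1
    have h2 := congrFun (h1.resolve_left (by positivity))
      (List.ofFn (Fin.cons u w : Fin (2 * k + 1) → TangentSpace 𝓘(ℝ, E) x))
    rw [ins_onLists, one_shuffle_ofFn, Fin.sum_univ_succ, Finset.sum_eq_zero, Fin.removeNth_zero,
      Fin.tail_cons, onLists_ofFn, hS.extD_eta hnabla] at h2
    · simp [hu, hw] at h2
    · intro i _
      rw [hS.extD_eta hnabla]
      simp [hg]

/-- Since φξ = 0 gives ξ⌟ω = 0, contraction with ξ turns η ∧ ω^k into ε ω^k. -/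
theorem contactForm_apply_ne_zero (hnabla : IsLeviCivita g nabla)
    (hS : IsMixedThreeSasakian g nabla S) (α : Fin 3) (x : M) (k : ℕ)
    (hk : 2 * k < Module.finrank ℝ E + 1) :
    contactForm (oneForm (S.η α)) k x ≠ 0 := by
  intro h0
  have h1 : onLists (contactForm (oneForm (S.η α)) k x) = 0 := by
    rw [h0]
    exact (onLists_hasDegree _).ext (p := 2 * k + 1) (fun _ _ ↦ rfl) fun w ↦ by
      rw [onLists_ofFn]; rfl
  have hω : ins (onLists (extD (oneForm (S.η α)) x)) (S.ξ α x) = 0 := by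
    rw [ins_onLists]
    refine (onLists_hasDegree _).ext (p := 1) (fun _ _ ↦ rfl) fun w ↦ ?_
    rw [onLists_ofFn, hS.extD_eta hnabla, Fin.cons_zero, ← neg_neg (g.val x _ _),
      ← hS.val_phi_left, S.phi_xi_self]
    simp
  have hP : ins (onLists (wedgePow (extD (oneForm (S.η α))) k x)) (S.ξ α x) = 0 := by
    cases k with
    | zero => rw [onLists_wedgePow_zero, ins_unitFun]
    | succ k => rw [ins_onLists_wedgePow_succ, hω, shuffle_zero_left, smul_zero]
  have h2 := congrArg (fun a ↦ ins a (S.ξ α x)) h1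
  simp only [contactForm, onLists_wedge, ins_shuffle, hP, shuffle_zero_right, add_zero,
    ins_onLists_one, shuffle_smul_left, unitFun_shuffle, ins_zero] at h2
  have h3 : oneForm (S.η α) x (fun _ ↦ S.ξ α x) = eps α := S.η_ξ_self α x
  rw [h3] at h2
  exact hS.onLists_wedgePow_extD_eta_ne_zero hnabla α x k hk
    ((smul_eq_zero.1 h2).resolve_left (eps_ne_zero α))

end IsMixedThreeSasakian

end Contact

end MixedSasaki

end

theorem corollary4p2 {n : ℕ} {E : Type*} [NormedAddCommGroup E] [NormedSpace ℝ E]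
    [FiniteDimensional ℝ E] (hE : Module.finrank ℝ E = 4 * n + 3)
    {M : Type*} [TopologicalSpace M] [ChartedSpace E M] [IsManifold 𝓘(ℝ, E) ∞ M] [Nonempty M]
    (g : MixedSasaki.SemiRiemannianMetric E M)
    (nabla : MixedSasaki.Connection E M) (hnabla : MixedSasaki.IsLeviCivita g nabla)
    (S : MixedSasaki.MixedThreeStructure E M)
    (hS : MixedSasaki.IsMixedThreeSasakian g nabla S) :
    -- (i)
    ((∀ α, MixedSasaki.IsKillingField g (S.ξ α)) ∧
      (∀ x, g.val x (S.ξ 0 x) (S.ξ 0 x) = 1) ∧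
      (∀ x, g.val x (S.ξ 1 x) (S.ξ 1 x) = -1) ∧
      (∀ x, g.val x (S.ξ 2 x) (S.ξ 2 x) = -1)) ∧
    -- (ii)
    (∀ α, MixedSasaki.IsConformalKillingYano g nabla (MixedSasaki.oneForm (S.η α))) ∧
    -- (iii)
    (∀ α, MixedSasaki.IsStrictlyConformalKillingYano g nabla
      (MixedSasaki.extD (MixedSasaki.oneForm (S.η α)))) ∧
    -- (iv)
    (∀ k : ℕ, k ≤ 2 * n + 1 →
      (∀ c : Fin 3 → ℝ, MixedSasaki.IsKillingYano g nabla
        (∑ α, c α • MixedSasaki.contactForm (MixedSasaki.oneForm (S.η α)) k)) ∧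
      ∃ θ : MixedSasaki.Form E M (2 * k + 1), MixedSasaki.IsKillingYano g nabla θ ∧ θ ≠ 0) := by
  have hE1 : Module.finrank ℝ E ≠ 1 := by omega
  have hval := hS.toIsCompatibleMetric.val_xi_self
  refine ⟨⟨fun α ↦ hS.isKillingField_xi hnabla α, fun x ↦ ?_, fun x ↦ ?_, fun x ↦ ?_⟩,
    fun α ↦ (hS.isKillingYano_eta hnabla α).1,
    fun α ↦ hS.isStrictlyConformalKillingYano_extD_eta hE1 hnabla α,
    fun k hk ↦ ⟨hS.isKillingYano_sum_contactForm hnabla k,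
      MixedSasaki.contactForm (MixedSasaki.oneForm (S.η 0)) k,
      hS.isKillingYano_contactForm hnabla 0 k, fun h ↦ ?_⟩⟩
  · simpa [MixedSasaki.eps] using hval 0 x
  · simpa [MixedSasaki.eps] using hval 1 x
  · simpa [MixedSasaki.eps] using hval 2 x
  · obtain ⟨x⟩ := ‹Nonempty M›
    -- The degree bound holds because 2k ≤ 4n + 2 < (4n + 3) + 1.
    exact hS.contactForm_apply_ne_zero hnabla 0 x k (by omega) (congrFun h x)
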